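/- Let $n\ge 1$, $d\ge 2$ and $0\le k\le d$ be integers, and let $x_1,\ldots,x_n\in\mathbb{R}^d$ be deterministic points, not all zero. Define $\sigma>0$ and $A\ge 0$ by $$\frac1n\sum_{i=1}^n|x_i|^2=\sigma^2d,\qquad A:=\frac1n\sum_{i=1}^n\bigl|\sigma^{-2}|x_i|^2-d\bigr|.$$ Let $\theta=(\theta_1,\ldots,\theta_k)$ be a random point of the Stiefel manifold $\mathfrak{W}_{d,k}$ of orthonormal $k$-frames in $\mathbb{R}^d$, distributed according to its rotation-invariant (Haar) probability measure, and let $$\mu^\theta:=\frac1n\sum_{i=1}^n\delta_{(\langle\theta_1,x_i\rangle,\ldots,\langle\theta_k,x_i\rangle)}$$ be the empirical measure on $\mathbb{R}^k$ of the projected points. Let $X_\theta$ be a random vector in $\mathbb{R}^k$ whose conditional distribution given $\theta$ is $\mu^\theta$ (so that, unconditionally, $X_\theta$ has the law $\mu^\theta$ averaged over $\theta$), and let $Z$ be a standard Gaussian random vector in $\mathbb{R}^k$. Then $$d_W(X_\theta,\sigma Z)\le\frac{\sigma\sqrt{k}\,(A+1)+\sigma k}{d-1},$$ where $d_W(X,Y)=\sup\bigl\{|\mathbb{E}f(Y)-\mathbb{E}f(X)|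 : f:\mathbb{R}^k\to\mathbb{R},\ |f(x)-f(y)|\le|x-y|\ \text{for all }x,y\bigr\}$ is the Wasserstein distance between the (unconditional) laws. -/

import Mathlib

open MeasureTheory ProbabilityTheory
open scoped ENNReal NNReal

namespace RandomProjection

noncomputable section

/-! ### The Stiefel manifold and its rotation-invariant probability measure -/

/-- The Stiefel manifold of orthonormal `k`-frames in `ℝ^d`. -/
def Stiefel (d k : ℕ) : Type :=
  {θ : Fin k → EuclideanSpace ℝ (Fin d) //
    ∀ i j, inner ℝ (θ i) (θ j) = if i = j then (1 : ℝ) else 0}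

instance (d k : ℕ) : MeasurableSpace (Stiefel d k) :=
  inferInstanceAs (MeasurableSpace {θ : Fin k → EuclideanSpace ℝ (Fin d) //
    ∀ i j, inner ℝ (θ i) (θ j) = if i = j then (1 : ℝ) else 0})

/-- The orthogonal group `O(d)`, with its Borel σ-algebra. -/
abbrev O (d : ℕ) : Type := Matrix.orthogonalGroup (Fin d) ℝ

instance (d : ℕ) : MeasurableSpace (O d) := borel _

instance (d : ℕ) : BorelSpace (O d) := ⟨rfl⟩

instance (d : ℕ) : CompactSpace (O d) := by
  refine isCompact_iff_compactSpace.mp ?_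
  have hK : IsCompact (Set.univ.pi fun _ : Fin d => Set.univ.pi fun _ : Fin d =>
      Metric.closedBall (0 : ℝ) 1) :=
    isCompact_univ_pi fun _ => isCompact_univ_pi fun _ => isCompact_closedBall _ _
  refine IsCompact.of_isClosed_subset (X := Matrix (Fin d) (Fin d) ℝ) hK
    (isClosed_unitary (R := Matrix (Fin d) (Fin d) ℝ)) ?_
  intro U hU i _ j _
  simpa using entry_norm_bound_of_unitary (𝕜 := ℝ) hU i j

/-- The Haar probability measure of the compact group `O(d)`. -/
def orthogonalHaar (d : ℕ) : Measure (O d) := Measure.haarMeasure ⊤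

instance (d : ℕ) : IsProbabilityMeasure (orthogonalHaar d) :=
  ⟨by simpa [orthogonalHaar] using Measure.haarMeasure_self (G := O d) (K₀ := ⊤)⟩

/-- The image `U v` of a vector `v` of `ℝ^d` under `U ∈ O(d)`. -/
def rot {d : ℕ} (U : O d) (v : EuclideanSpace ℝ (Fin d)) : EuclideanSpace ℝ (Fin d) :=
  WithLp.toLp 2 (U.1.mulVec v.ofLp)

theorem inner_rot {d : ℕ} (U : O d) (v w : EuclideanSpace ℝ (Fin d)) :
    inner ℝ (rot U v) (rot U w) = inner ℝ v w := by
  have hU : U.1.transpose * U.1 = 1 := by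
    exact (Matrix.mem_unitaryGroup_iff' (A := U.1)).mp U.2
  simp only [rot, EuclideanSpace.inner_eq_star_dotProduct, star_trivial]
  rw [Matrix.dotProduct_mulVec, Matrix.vecMul_mulVec, hU, Matrix.vecMul_one]

/-- The action of `O(d)` on frames: `(θ₁, …, θ_k) ↦ (U θ₁, …, U θ_k)`. -/
def Stiefel.rotate {d k : ℕ} (U : O d) (θ : Stiefel d k) : Stiefel d k :=
  ⟨fun i => rot U (θ.1 i), fun i j => by rw [inner_rot, θ.2 i j]⟩

/-- The frame `(e₁, …, e_k)` of the first `k` standard basis vectors of `ℝ^d`. -/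
def Stiefel.base {d k : ℕ} (hk : k ≤ d) : Stiefel d k :=
  ⟨fun i => EuclideanSpace.single (Fin.castLE hk i) 1, fun i j => by
    simp [EuclideanSpace.inner_single_left, Fin.ext_iff]⟩

/-- The rotation-invariant probability measure on the Stiefel manifold: the law of
`(U e₁, …, U e_k)` for a Haar-distributed `U ∈ O(d)`. -/
def stiefelHaar {d k : ℕ} (hk : k ≤ d) : Measure (Stiefel d k) :=
  (orthogonalHaar d).map fun U => Stiefel.rotate U (Stiefel.base hk)

theorem measurable_rotate_left {d k : ℕ} (θ : Stiefel d k) :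
    Measurable fun U : O d => Stiefel.rotate U θ := by
  refine Measurable.subtype_mk (measurable_pi_iff.mpr fun i => Continuous.measurable ?_)
  unfold rot
  exact (PiLp.continuous_toLp 2 _).comp
    (Continuous.matrix_mulVec continuous_subtype_val continuous_const)

theorem measurable_rotate_right {d k : ℕ} (U : O d) :
    Measurable (Stiefel.rotate U : Stiefel d k → Stiefel d k) := by
  refine Measurable.subtype_mk (measurable_pi_iff.mpr fun i => ?_)
  have h : Continuous (rot U) := (PiLp.continuous_toLp 2 _).comp
    (Continuous.matrix_mulVec continuous_const (PiLp.continuous_ofLp 2 _))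
  exact h.measurable.comp ((measurable_pi_apply i).comp measurable_subtype_coe)

instance {d k : ℕ} (hk : k ≤ d) : IsProbabilityMeasure (stiefelHaar hk) :=
  Measure.isProbabilityMeasure_map (measurable_rotate_left _).aemeasurable

/-- `stiefelHaar` is rotation-invariant. -/
theorem map_rotate_stiefelHaar {d k : ℕ} (hk : k ≤ d) (V : O d) :
    (stiefelHaar hk).map (Stiefel.rotate V) = stiefelHaar hk := by
  have hinv : (orthogonalHaar d).map (fun U => V * U) = orthogonalHaar d :=
    map_mul_left_eq_self (Measure.haarMeasure (⊤ : TopologicalSpace.PositiveCompacts (O d))) V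
  rw [stiefelHaar, Measure.map_map (measurable_rotate_right V) (measurable_rotate_left _)]
  conv_rhs => rw [← hinv]
  rw [Measure.map_map (measurable_rotate_left _) (measurable_const_mul V)]
  congr 1
  funext U
  refine Subtype.ext (funext fun i => ?_)
  change rot V (rot U _) = rot (V * U) _
  simp [rot, Matrix.mulVec_mulVec]

/-! ### Projections of the data -/

/-- The projection `(⟨x, θ₁⟩, …, ⟨x, θ_k⟩) ∈ ℝ^k` of `x ∈ ℝ^d`. -/
def proj {d k : ℕ} (θ : Stiefel d k) (x : EuclideanSpace ℝ (Fin d)) :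
    EuclideanSpace ℝ (Fin k) :=
  WithLp.toLp 2 fun i => inner ℝ x (θ.1 i)

theorem measurable_proj {d k : ℕ} (x : EuclideanSpace ℝ (Fin d)) :
    Measurable fun θ : Stiefel d k => proj θ x := by
  have h : Continuous fun θ : Fin k → EuclideanSpace ℝ (Fin d) =>
      (WithLp.toLp 2 fun i => inner ℝ x (θ i) : EuclideanSpace ℝ (Fin k)) :=
    (PiLp.continuous_toLp 2 _).comp (by fun_prop)
  exact h.measurable.comp measurable_subtype_coe

/-- The random measure `θ ↦ μ^θ = (1/n) ∑ᵢ δ_{(⟨θ₁, xᵢ⟩, …, ⟨θ_k, xᵢ⟩)}` on `ℝ^k`. -/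
def projectedEmpirical {n d : ℕ} (k : ℕ) (x : Fin n → EuclideanSpace ℝ (Fin d)) :
    Kernel (Stiefel d k) (EuclideanSpace ℝ (Fin k)) where
  toFun θ := (n : ℝ≥0∞)⁻¹ • ∑ i, Measure.dirac (proj θ (x i))
  measurable' := by
    refine Measure.measurable_of_measurable_coe _ fun s hs => ?_
    simp only [Measure.smul_apply, Measure.finsetSum_apply, smul_eq_mul]
    refine Measurable.const_mul (Finset.measurable_sum _ fun i _ => ?_) _
    exact (Measure.measurable_coe hs).comp (Measure.measurable_dirac.comp (measurable_proj (x i)))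

theorem isMarkovKernel_projectedEmpirical {n d : ℕ} (hn : 1 ≤ n) (k : ℕ)
    (x : Fin n → EuclideanSpace ℝ (Fin d)) : IsMarkovKernel (projectedEmpirical k x) := by
  refine ⟨fun θ => ⟨?_⟩⟩
  change ((n : ℝ≥0∞)⁻¹ • ∑ i, Measure.dirac (proj θ (x i)) : Measure _) Set.univ = 1
  simp only [Measure.smul_apply, Measure.finsetSum_apply, measure_univ, Finset.sum_const,
    Finset.card_univ, Fintype.card_fin, nsmul_eq_mul, mul_one, smul_eq_mul]
  exact ENNReal.inv_mul_cancel (by exact_mod_cast (by omega : n ≠ 0)) (ENNReal.natCast_ne_top n)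

/-! ### The Wasserstein distance -/

/-- The Wasserstein distance `sup_f |𝔼 f(Y) - 𝔼 f(X)|` between two random vectors with finite
first moment, the supremum being over all `f` with `|f(x) - f(y)| ≤ |x - y|`; it takes values in
`[0, ∞]`, so no boundedness is presupposed. -/
def dW {E Ω Ω' : Type*} [NormedAddCommGroup E] [MeasurableSpace Ω] [MeasurableSpace Ω']
    (P : Measure Ω) (X : Ω → E) (Q : Measure Ω') (Y : Ω' → E) : ℝ≥0∞ :=
  ⨆ (f : E → ℝ) (_ : ∀ x y, |f x - f y| ≤ ‖x - y‖),
    ENNReal.ofReal |(∫ ω, f (Y ω) ∂Q) - ∫ ω, f (X ω) ∂P|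

end

end RandomProjection

/-!
Projections of data points along a Haar-distributed orthonormal frame are close to Gaussian.

Let `U` be a Haar-distributed rotation. Then `v = Uᵀ x` has a rotation-invariant law on the sphere
of radius `r = |x|`, and the projection of `x` along the frame `(U e₁, …, U e_k)` is `π v`, where
`π` keeps the first `k` coordinates. Since the bound is an average over the data points of a bound
for each of them, a single `x` suffices; the test function `f` may be taken smooth, because
`1`-Lipschitz functions are uniform limits of smooth ones (`exists_contDiff_abs_sub_le`).

For independent `v` and a standard Gaussian `z`, put `Y = s π v + c z` with `s = sin α` and
`c = σ cos α`. As `α` runs from `0` to `π / 2`, `𝔼 f(Y)` goes from `𝔼 f(σ z)` to `𝔼 f(π v)`, with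
derivative `cos α 𝔼 Df(Y)(π v) - σ sin α 𝔼 Df(Y)(z)`. Two integrations by parts compare the terms:

* on the sphere (`integral_fderiv_proj_sphere`), where the radius and the curvature enter:
  `(d - 1) 𝔼 Df(Y)(π v) = s 𝔼 [r² Δf(Y) - D²f(Y)(π v, π v)]`;
* for the Gaussian (`integral_inner_mul_stdGaussian`), which is used to trade the second
  derivatives back for first ones: `c 𝔼 Δf(Y) = 𝔼 Df(Y)(z)` and
  `c 𝔼 D²f(Y)(π v, π v) = 𝔼 ⟨π v, z⟩ Df(Y)(π v)`.

Both follow from one principle, `integral_deriv_eq_zero_of_measurePreserving`: the rotations of a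
coordinate plane preserve the law of `v`, and the rotations mixing two independent copies preserve
a centred Gaussian law, so derivatives along these flows have mean zero. The outcome is
`σ (d - 1) d/dα 𝔼 f(Y) = sin α 𝔼 [(r² - σ² (d - 1)) Df(Y)(z) - ⟨π v, z⟩ Df(Y)(π v)]`.
With `|Df| ≤ 1`, `𝔼 |z| ≤ √k`, `𝔼 |⟨y, z⟩| ≤ |y|` and `𝔼 |π v|² = r² k / d`, integrating over
`[0, π / 2]` gives
`|𝔼 f(π v) - 𝔼 f(σ z)| ≤ (|r² - σ² (d - 1)| √k + r² k / d) / (σ (d - 1))`,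
and the average over the data is the theorem.
-/

namespace RandomProjection

open scoped RealInnerProductSpace

/-! ### Flows preserving a measure -/

/-- If every map `T t` of a differentiable flow preserves `ν`, then `∫ Ψ (T t a) ∂ν` does not depend
on `t`, so its derivative at `t = 0` vanishes. All integrations by parts below, Gaussian and
spherical, are instances of this. -/
theorem integral_deriv_eq_zero_of_measurePreserving {α : Type*} [MeasurableSpace α]
    {ν : Measure α} {T : ℝ → α → α} (hT : ∀ t, MeasurePreserving (T t) ν ν)
    {Ψ : α → ℝ} (hΨ : Integrable Ψ ν) {F' : ℝ → α → ℝ} {bound : α → ℝ}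
    (hF' : AEStronglyMeasurable (F' 0) ν) (hle : ∀ᵐ a ∂ν, ∀ t, ‖F' t a‖ ≤ bound a)
    (hbound : Integrable bound ν)
    (hderiv : ∀ a t, HasDerivAt (fun t => Ψ (T t a)) (F' t a) t) :
    ∫ a, F' 0 a ∂ν = 0 := by
  have hint : ∀ t, Integrable (fun a => Ψ (T t a)) ν := fun t =>
    (hT t).integrable_comp_of_integrable hΨ
  have hconst : ∀ t, ∫ a, Ψ (T t a) ∂ν = ∫ a, Ψ a ∂ν := fun t => by
    have h := integral_map (hT t).measurable.aemeasurable
      (f := Ψ) (by rw [(hT t).map_eq]; exact hΨ.aestronglyMeasurable)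
    rw [← h, (hT t).map_eq]
  have h := (hasDerivAt_integral_of_dominated_loc_of_deriv_le (F := fun t a => Ψ (T t a))
    (x₀ := (0 : ℝ)) Filter.univ_mem
    (Filter.Eventually.of_forall fun t => (hint t).aestronglyMeasurable) (hint 0) hF'
    (hle.mono fun a ha t _ => ha t) hbound
    (Filter.Eventually.of_forall fun a t _ => hderiv a t)).2
  simp only [hconst] at h
  exact h.unique (hasDerivAt_const _ _)

/-! ### The standard Gaussian measure -/

section Gaussian

variable {E : Type*} [NormedAddCommGroup E] [InnerProductSpace ℝ E] [FiniteDimensional ℝ E]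
  [MeasurableSpace E] [BorelSpace E]

theorem integrable_norm_stdGaussian : Integrable (fun z : E => ‖z‖) (stdGaussian E) :=
  IsGaussian.integrable_id.norm

theorem integrable_norm_sq_stdGaussian : Integrable (fun z : E => ‖z‖ ^ 2) (stdGaussian E) := by
  have h := (IsGaussian.memLp_two_id (μ := stdGaussian E)).integrable_norm_pow (by norm_num)
  simpa using h

theorem integral_inner_mul_inner_stdGaussian (v w : E) :
    ∫ z, ⟪v, z⟫ * ⟪w, z⟫ ∂stdGaussian E = ⟪v, w⟫ := by
  have h := covarianceBilin_apply (μ := stdGaussian E) IsGaussian.memLp_two_id v w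
  simp only [covarianceBilin_stdGaussian, id_eq, integral_id_stdGaussian, sub_zero] at h
  exact h.symm

theorem integral_norm_sq_stdGaussian :
    ∫ z, ‖z‖ ^ 2 ∂stdGaussian E = Module.finrank ℝ E := by
  let b := stdOrthonormalBasis ℝ E
  have h : ∀ z : E, ‖z‖ ^ 2 = ∑ i, ⟪b i, z⟫ * ⟪b i, z⟫ := fun z => by
    rw [← b.sum_sq_inner_right z]
    exact Finset.sum_congr rfl fun i _ => sq _
  simp_rw [h]
  rw [integral_finsetSum]
  · simp [integral_inner_mul_inner_stdGaussian]
  · intro i _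
    refine (integrable_norm_sq_stdGaussian (E := E)).mono (by fun_prop)
      (Filter.Eventually.of_forall fun z => ?_)
    have := abs_real_inner_le_norm (b i) z
    simp only [OrthonormalBasis.norm_eq_one, one_mul] at this
    rw [norm_mul, Real.norm_eq_abs, Real.norm_of_nonneg (by positivity), ← sq]
    gcongr

/-- Monotonicity of `Lᵖ` norms on a probability space: `(𝔼 h)² ≤ 𝔼 h²`, in the form of an upper
bound. -/
theorem integral_le_of_integral_sq_le {α : Type*} [MeasurableSpace α] {ν : Measure α}
    [IsProbabilityMeasure ν] {h : α → ℝ} {m : ℝ} (hm : 0 ≤ m) (hi : Integrable h ν)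
    (hi2 : Integrable (fun a => h a ^ 2) ν) (hle : ∫ a, h a ^ 2 ∂ν ≤ m ^ 2) :
    ∫ a, h a ∂ν ≤ m := by
  have hv := variance_nonneg h ν
  rw [variance_eq_sub ((memLp_two_iff_integrable_sq hi.aestronglyMeasurable).2 hi2)] at hv
  refine abs_le_of_sq_le_sq' ?_ hm |>.2
  have : ∫ a, (h ^ 2) a ∂ν = ∫ a, h a ^ 2 ∂ν := rfl
  linarith

theorem integral_norm_stdGaussian_le :
    ∫ z, ‖z‖ ∂stdGaussian E ≤ √(Module.finrank ℝ E) := by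
  refine integral_le_of_integral_sq_le (by positivity) integrable_norm_stdGaussian
    integrable_norm_sq_stdGaussian ?_
  rw [integral_norm_sq_stdGaussian, Real.sq_sqrt (by positivity)]

theorem integral_abs_inner_stdGaussian_le (w : E) :
    ∫ z, |⟪w, z⟫| ∂stdGaussian E ≤ ‖w‖ := by
  have hle : ∀ z : E, |⟪w, z⟫| ≤ ‖w‖ * ‖z‖ := fun z => abs_real_inner_le_norm w z
  refine integral_le_of_integral_sq_le (by positivity) ?_ ?_ ?_
  · refine (integrable_norm_stdGaussian.const_mul ‖w‖).mono' (by fun_prop)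
      (Filter.Eventually.of_forall fun z => ?_)
    simpa using hle z
  · refine (integrable_norm_sq_stdGaussian.const_mul (‖w‖ ^ 2)).mono' (by fun_prop)
      (Filter.Eventually.of_forall fun z => ?_)
    rw [Real.norm_of_nonneg (by positivity), ← mul_pow]
    exact pow_le_pow_left₀ (abs_nonneg _) (hle z) 2
  · simp_rw [sq_abs, sq, integral_inner_mul_inner_stdGaussian, real_inner_self_eq_norm_mul_norm]
    exact le_rfl

/-- **Gaussian integration by parts.** The product of two standard Gaussian measures is invariant
under the rotations `(z, z') ↦ (cos t z + sin t z', -sin t z + cos t z')`; differentiating the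
integral of `g z * ⟪w, z'⟫` along them and integrating out `z'` gives the formula. -/
theorem integral_inner_mul_stdGaussian {g : E → ℝ} (hg : ContDiff ℝ 1 g) {C₀ C₁ : ℝ}
    (h₀ : ∀ z, |g z| ≤ C₀) (h₁ : ∀ z, ‖fderiv ℝ g z‖ ≤ C₁) (w : E) :
    ∫ z, ⟪w, z⟫ * g z ∂stdGaussian E = ∫ z, fderiv ℝ g z w ∂stdGaussian E := by
  have hC₀ : 0 ≤ C₀ := (abs_nonneg _).trans (h₀ 0)
  have hC₁ : 0 ≤ C₁ := (norm_nonneg _).trans (h₁ 0)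
  set γ := stdGaussian E with hγ
  have hg' : Continuous (fderiv ℝ g) := hg.continuous_fderiv (by norm_num)
  have hcg := hg.continuous
  let T : ℝ → E × E → E × E := fun t => ContinuousLinearMap.rotation t
  have hT : ∀ t, MeasurePreserving (T t) (γ.prod γ) (γ.prod γ) := fun t =>
    ⟨(ContinuousLinearMap.rotation t).continuous.measurable,
      IsGaussian.map_rotation_eq_self integral_id_stdGaussian t⟩
  let F' : ℝ → E × E → ℝ := fun t p =>
    fderiv ℝ g (T t p).1 (T t p).2 * ⟪w, (T t p).2⟫ - g (T t p).1 * ⟪w, (T t p).1⟫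
  have hi1 : Integrable (fun p : E × E => ‖p.1‖) (γ.prod γ) :=
    integrable_norm_stdGaussian.comp_fst γ
  have hi2 : Integrable (fun p : E × E => ‖p.2‖) (γ.prod γ) :=
    integrable_norm_stdGaussian.comp_snd γ
  have hi1' : Integrable (fun p : E × E => ‖p.1‖ ^ 2) (γ.prod γ) :=
    integrable_norm_sq_stdGaussian.comp_fst γ
  have hi2' : Integrable (fun p : E × E => ‖p.2‖ ^ 2) (γ.prod γ) :=
    integrable_norm_sq_stdGaussian.comp_snd γ
  have hn1 : ∀ t p, ‖(T t p).1‖ ≤ ‖p.1‖ + ‖p.2‖ := fun t p => by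
    refine (norm_add_le _ _).trans (add_le_add ?_ ?_) <;> rw [norm_smul] <;>
      exact mul_le_of_le_one_left (norm_nonneg _)
        (by simp [Real.norm_eq_abs, Real.abs_cos_le_one, Real.abs_sin_le_one])
  have hn2 : ∀ t p, ‖(T t p).2‖ ≤ ‖p.1‖ + ‖p.2‖ := fun t p => by
    refine (norm_add_le _ _).trans (add_le_add ?_ ?_) <;> rw [norm_smul] <;>
      exact mul_le_of_le_one_left (norm_nonneg _)
        (by simp [Real.norm_eq_abs, Real.abs_cos_le_one, Real.abs_sin_le_one])
  have hF'le : ∀ p t, ‖F' t p‖ ≤ 2 * C₁ * ‖w‖ * ‖p.1‖ ^ 2 + 2 * C₁ * ‖w‖ * ‖p.2‖ ^ 2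
      + C₀ * ‖w‖ * ‖p.1‖ + C₀ * ‖w‖ * ‖p.2‖ := fun p t => by
    have a1 : ‖fderiv ℝ g (T t p).1 (T t p).2‖ ≤ C₁ * (‖p.1‖ + ‖p.2‖) :=
      (ContinuousLinearMap.le_opNorm _ _).trans
        (mul_le_mul (h₁ _) (hn2 t p) (norm_nonneg _) hC₁)
    have a2 : ‖⟪w, (T t p).2⟫‖ ≤ ‖w‖ * (‖p.1‖ + ‖p.2‖) :=
      (norm_inner_le_norm _ _).trans (by gcongr; exact hn2 t p)
    have a3 : ‖⟪w, (T t p).1⟫‖ ≤ ‖w‖ * (‖p.1‖ + ‖p.2‖) :=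
      (norm_inner_le_norm _ _).trans (by gcongr; exact hn1 t p)
    have a4 : ‖F' t p‖ ≤ C₁ * (‖p.1‖ + ‖p.2‖) * (‖w‖ * (‖p.1‖ + ‖p.2‖))
        + C₀ * (‖w‖ * (‖p.1‖ + ‖p.2‖)) := by
      refine (norm_sub_le _ _).trans (add_le_add ?_ ?_) <;> rw [norm_mul]
      · exact mul_le_mul a1 a2 (norm_nonneg _) (by positivity)
      · exact mul_le_mul (h₀ _) a3 (norm_nonneg _) hC₀
    refine a4.trans ?_
    have : 0 ≤ C₁ * ‖w‖ * (‖p.1‖ - ‖p.2‖) ^ 2 := by positivity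
    nlinarith
  have hbound := (((hi1'.const_mul (2 * C₁ * ‖w‖)).add (hi2'.const_mul (2 * C₁ * ‖w‖))).add
    (hi1.const_mul (C₀ * ‖w‖))).add (hi2.const_mul (C₀ * ‖w‖))
  have hT0 : ∀ p, T 0 p = p := fun p => by
    simp [T, ContinuousLinearMap.rotation_apply]
  have hF0 : F' 0 = fun p => fderiv ℝ g p.1 p.2 * ⟪w, p.2⟫ - g p.1 * ⟪w, p.1⟫ := by
    funext p; simp only [F', hT0]
  have hFm : AEStronglyMeasurable (F' 0) (γ.prod γ) := by
    rw [hF0]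
    exact Continuous.aestronglyMeasurable (by fun_prop)
  have hΨ : Integrable (fun p : E × E => g p.1 * ⟪w, p.2⟫) (γ.prod γ) := by
    refine (hi2.const_mul (C₀ * ‖w‖)).mono' (by fun_prop)
      (Filter.Eventually.of_forall fun p => ?_)
    rw [norm_mul, mul_assoc]
    exact mul_le_mul (h₀ _) (norm_inner_le_norm _ _) (norm_nonneg _) hC₀
  have key := integral_deriv_eq_zero_of_measurePreserving (F' := F') hT hΨ hFm
    (Filter.Eventually.of_forall hF'le) hbound (fun p t => by
      have d1 : HasDerivAt (fun t => (T t p).1) (T t p).2 t := by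
        have := ((Real.hasDerivAt_cos t).smul_const p.1).add
          ((Real.hasDerivAt_sin t).smul_const p.2)
        exact this
      have d2 : HasDerivAt (fun t => (T t p).2) (-(T t p).1) t := by
        have := ((Real.hasDerivAt_sin t).neg.smul_const p.1).add
          ((Real.hasDerivAt_cos t).smul_const p.2)
        convert! this using 1
        simp only [T, ContinuousLinearMap.rotation_apply]
        module
      have d3 := ((hg.differentiable (by norm_num) (T t p).1).hasFDerivAt.comp_hasDerivAt t d1).mul
        ((innerSL ℝ w).hasFDerivAt.comp_hasDerivAt t d2)
      convert! d3 using 1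
      simp [F', sub_eq_add_neg])
  rw [hF0] at key
  have hA : Integrable (fun p : E × E => fderiv ℝ g p.1 p.2 * ⟪w, p.2⟫) (γ.prod γ) := by
    refine (hi2'.const_mul (C₁ * ‖w‖)).mono' (Continuous.aestronglyMeasurable (by fun_prop))
      (Filter.Eventually.of_forall fun p => ?_)
    rw [norm_mul]
    calc _ ≤ (C₁ * ‖p.2‖) * (‖w‖ * ‖p.2‖) :=
          mul_le_mul ((ContinuousLinearMap.le_opNorm _ _).trans (by gcongr; exact h₁ _))
            (norm_inner_le_norm _ _) (norm_nonneg _) (by positivity)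
      _ = _ := by ring
  have hB : Integrable (fun p : E × E => g p.1 * ⟪w, p.1⟫) (γ.prod γ) := by
    refine (hi1.const_mul (C₀ * ‖w‖)).mono' (by fun_prop)
      (Filter.Eventually.of_forall fun p => ?_)
    rw [norm_mul, mul_assoc]
    exact mul_le_mul (h₀ _) (norm_inner_le_norm _ _) (norm_nonneg _) hC₀
  rw [integral_sub hA hB, integral_prod _ hA, integral_prod _ hB, sub_eq_zero] at key
  have hinner : ∀ z : E, ∫ z', fderiv ℝ g z z' * ⟪w, z'⟫ ∂γ = fderiv ℝ g z w := fun z => by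
    have h := integral_inner_mul_inner_stdGaussian
      ((InnerProductSpace.toDual ℝ E).symm (fderiv ℝ g z)) w
    simpa [InnerProductSpace.toDual_symm_apply] using h
  simp only [hinner, integral_const, probReal_univ, one_smul] at key
  rw [key]
  exact integral_congr_ae (Filter.Eventually.of_forall fun z => mul_comm _ _)

end Gaussian

/-! ### Rotation-invariant measures on a sphere -/

theorem apply_eq_sum_inner {E ι : Type*} [NormedAddCommGroup E] [InnerProductSpace ℝ E] [Fintype ι]
    (b : OrthonormalBasis ι ℝ E) (L : E →L[ℝ] ℝ) (v : E) : L v = ∑ i, ⟪b i, v⟫ * L (b i) := by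
  conv_lhs => rw [← b.sum_repr' v]
  simp only [map_sum, map_smul, smul_eq_mul]

section Sphere

variable {E : Type*} [NormedAddCommGroup E] [InnerProductSpace ℝ E] [FiniteDimensional ℝ E]

/-- The rotation by the angle `t` in the plane spanned by the orthonormal vectors `u` and `w`,
which fixes the orthogonal complement of that plane. -/
noncomputable def planeRotation (u w : E) (hu : ‖u‖ = 1) (hw : ‖w‖ = 1) (huw : ⟪u, w⟫ = 0)
    (t : ℝ) : E ≃ₗᵢ[ℝ] E :=
  LinearIsometry.toLinearIsometryEquiv
    { toFun := fun v => v + ((Real.cos t - 1) * ⟪u, v⟫ - Real.sin t * ⟪w, v⟫) • u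
        + (Real.sin t * ⟪u, v⟫ + (Real.cos t - 1) * ⟪w, v⟫) • w
      map_add' := fun v v' => by simp only [inner_add_right]; module
      map_smul' := fun c v => by simp only [real_inner_smul_right, RingHom.id_apply]; module
      norm_map' := fun v => by
        have h : ∀ p q : ℝ, ‖v + p • u + q • w‖ ^ 2
            = ‖v‖ ^ 2 + p ^ 2 + q ^ 2 + 2 * p * ⟪u, v⟫ + 2 * q * ⟪w, v⟫ := fun p q => by
          rw [norm_add_sq_real, norm_add_sq_real, inner_add_left, real_inner_smul_right,
            real_inner_smul_right, real_inner_smul_right, real_inner_smul_left, huw, norm_smul,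
            norm_smul, hu, hw, real_inner_comm, real_inner_comm v w]
          simp only [Real.norm_eq_abs, mul_one, sq_abs]
          ring
        rw [← sq_eq_sq₀ (norm_nonneg _) (norm_nonneg _)]
        refine (h _ _).trans ?_
        linear_combination (⟪u, v⟫ ^ 2 + ⟪w, v⟫ ^ 2) * Real.sin_sq_add_cos_sq t }
    rfl

theorem planeRotation_apply (u w : E) (hu : ‖u‖ = 1) (hw : ‖w‖ = 1) (huw : ⟪u, w⟫ = 0)
    (t : ℝ) (v : E) : planeRotation u w hu hw huw t v =
      v + ((Real.cos t - 1) * ⟪u, v⟫ - Real.sin t * ⟪w, v⟫) • u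
        + (Real.sin t * ⟪u, v⟫ + (Real.cos t - 1) * ⟪w, v⟫) • w := rfl

theorem hasDerivAt_planeRotation (u w : E) (hu : ‖u‖ = 1) (hw : ‖w‖ = 1) (huw : ⟪u, w⟫ = 0)
    (t : ℝ) (v : E) : HasDerivAt (fun t => planeRotation u w hu hw huw t v)
      (⟪u, planeRotation u w hu hw huw t v⟫ • w - ⟪w, planeRotation u w hu hw huw t v⟫ • u) t := by
  have h1 : ⟪u, planeRotation u w hu hw huw t v⟫
      = Real.cos t * ⟪u, v⟫ - Real.sin t * ⟪w, v⟫ := by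
    rw [planeRotation_apply, inner_add_right, inner_add_right, real_inner_smul_right,
      real_inner_smul_right, huw, real_inner_self_eq_norm_sq, hu]
    ring
  have h2 : ⟪w, planeRotation u w hu hw huw t v⟫
      = Real.sin t * ⟪u, v⟫ + Real.cos t * ⟪w, v⟫ := by
    rw [planeRotation_apply, inner_add_right, inner_add_right, real_inner_smul_right,
      real_inner_smul_right, real_inner_comm u w, huw, real_inner_self_eq_norm_sq, hw]
    ring
  rw [h1, h2]
  have hc := (Real.hasDerivAt_cos t).sub_const 1
  have hs := Real.hasDerivAt_sin t
  have := ((((hc.mul_const ⟪u, v⟫).sub (hs.mul_const ⟪w, v⟫)).smul_const u).const_add v).add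
    (((hs.mul_const ⟪u, v⟫).add (hc.mul_const ⟪w, v⟫)).smul_const w)
  convert! this using 1
  module

variable [MeasurableSpace E] [BorelSpace E] {ν : Measure E} {r : ℝ}

theorem integrable_of_continuous_of_norm_eq [IsFiniteMeasure ν] (hr : ∀ᵐ v ∂ν, ‖v‖ = r)
    {g : E → ℝ} (hg : Continuous g) : Integrable g ν := by
  obtain ⟨C, hC⟩ := (isCompact_closedBall (0 : E) r).exists_bound_of_continuousOn hg.continuousOn
  exact (integrable_const C).mono' hg.aestronglyMeasurable
    (hr.mono fun v hv => hC v (by simp [hv]))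

/-- The infinitesimal form of rotation invariance: a rotation-invariant measure annihilates the
derivatives of functions along the vector field `v ↦ ⟪u, v⟫ w - ⟪w, v⟫ u` generating the rotations
of the plane of `u` and `w`. -/
theorem integral_fderiv_planeRotation [IsFiniteMeasure ν]
    (hν : ∀ R : E ≃ₗᵢ[ℝ] E, MeasurePreserving R ν ν) (hr : ∀ᵐ v ∂ν, ‖v‖ = r)
    {Ψ : E → ℝ} (hΨ : ContDiff ℝ 1 Ψ) {u w : E} (hu : ‖u‖ = 1) (hw : ‖w‖ = 1)
    (huw : ⟪u, w⟫ = 0) :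
    ∫ v, fderiv ℝ Ψ v (⟪u, v⟫ • w - ⟪w, v⟫ • u) ∂ν = 0 := by
  have hc : Continuous fun v => fderiv ℝ Ψ v (⟪u, v⟫ • w - ⟪w, v⟫ • u) := by
    have := hΨ.continuous_fderiv (by norm_num)
    fun_prop
  obtain ⟨C, hC⟩ := (isCompact_closedBall (0 : E) r).exists_bound_of_continuousOn hc.continuousOn
  have h := integral_deriv_eq_zero_of_measurePreserving
    (T := fun t => planeRotation u w hu hw huw t)
    (F' := fun t v => (fun v => fderiv ℝ Ψ v (⟪u, v⟫ • w - ⟪w, v⟫ • u))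
      (planeRotation u w hu hw huw t v)) (bound := fun _ => C)
    (fun t => hν _) (integrable_of_continuous_of_norm_eq hr hΨ.continuous)
    (by
      have : Continuous (planeRotation u w hu hw huw 0) :=
        (planeRotation u w hu hw huw 0).continuous
      exact (hc.comp this).aestronglyMeasurable)
    (hr.mono fun v hv t => hC _ (by simp [hv])) (integrable_const C)
    (fun v t => (hΨ.differentiable (by norm_num) _).hasFDerivAt.comp_hasDerivAt t
      (hasDerivAt_planeRotation u w hu hw huw t v))
  simpa [planeRotation_apply] using h

/-- **Integration by parts on the sphere**, in terms of the ambient derivative: for a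
rotation-invariant measure on the sphere of radius `r`,
`(d - 1) 𝔼 ⟪u, v⟫ g = 𝔼 (r² ∂_u g - ⟪u, v⟫ ∂_v g)`. It is enough to treat the vectors `u = b j` of
an orthonormal basis; for these it is the sum over `i` of the infinitesimal rotation invariance in
the plane of `b i` and `b j`, applied to `⟪b i, v⟫ g v`. -/
theorem integral_inner_mul_sphere [IsFiniteMeasure ν]
    (hν : ∀ R : E ≃ₗᵢ[ℝ] E, MeasurePreserving R ν ν) (hr : ∀ᵐ v ∂ν, ‖v‖ = r)
    {g : E → ℝ} (hg : ContDiff ℝ 1 g) (u : E) :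
    ((Module.finrank ℝ E : ℝ) - 1) * ∫ v, ⟪u, v⟫ * g v ∂ν
      = r ^ 2 * ∫ v, fderiv ℝ g v u ∂ν - ∫ v, ⟪u, v⟫ * fderiv ℝ g v v ∂ν := by
  let b := stdOrthonormalBasis ℝ E
  have hg' := hg.continuous_fderiv (by norm_num)
  have hgc := hg.continuous
  have hint : ∀ {h : E → ℝ}, Continuous h → Integrable h ν := fun h =>
    integrable_of_continuous_of_norm_eq hr h
  have key : ∀ i j, ∫ v, (⟪b i, v⟫ * (⟪b i, v⟫ * fderiv ℝ g v (b j)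
      - ⟪b j, v⟫ * fderiv ℝ g v (b i))) ∂ν - (if i = j then 0 else 1) * ∫ v, ⟪b j, v⟫ * g v ∂ν
        = 0 := by
    intro i j
    by_cases hij : i = j
    · simp [hij]
    have h := integral_fderiv_planeRotation hν hr (Ψ := fun v => ⟪b i, v⟫ * g v)
      ((innerSL ℝ (b i)).contDiff.mul hg) (b.norm_eq_one i) (b.norm_eq_one j) (b.inner_eq_zero hij)
    have hd : ∀ v, fderiv ℝ (fun v => ⟪b i, v⟫ * g v) v (⟪b i, v⟫ • b j - ⟪b j, v⟫ • b i)
        = ⟪b i, v⟫ * (⟪b i, v⟫ * fderiv ℝ g v (b j) - ⟪b j, v⟫ * fderiv ℝ g v (b i))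
          - ⟪b j, v⟫ * g v := fun v => by
      have := ((innerSL ℝ (b i)).hasFDerivAt (x := v)).mul
        (hg.differentiable (by norm_num) v).hasFDerivAt
      have h1 : HasFDerivAt (fun v => ⟪b i, v⟫ * g v) _ v := this
      rw [h1.fderiv]
      simp [b.inner_eq_zero hij, inner_sub_right, real_inner_smul_right]
      ring
    simp_rw [hd] at h
    rw [integral_sub (hint (by fun_prop)) (hint (by fun_prop))] at h
    simpa [hij] using h
  have hbasis : ∀ j, ((Module.finrank ℝ E : ℝ) - 1) * ∫ v, ⟪b j, v⟫ * g v ∂ν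
      = r ^ 2 * ∫ v, fderiv ℝ g v (b j) ∂ν - ∫ v, ⟪b j, v⟫ * fderiv ℝ g v v ∂ν := by
    intro j
    have hsum := Finset.sum_eq_zero fun i (_ : i ∈ Finset.univ) => key i j
    rw [Finset.sum_sub_distrib, ← integral_finsetSum _ (fun i _ => hint (by fun_prop)),
      ← Finset.sum_mul] at hsum
    have hcount : ∑ i, (if i = j then (0 : ℝ) else 1) = (Module.finrank ℝ E : ℝ) - 1 := by
      have : ∀ i, (if i = j then (0 : ℝ) else 1) = 1 - if i = j then 1 else 0 := fun i => by
        split_ifs <;> norm_num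
      simp [this]
    have hpt : ∀ᵐ v ∂ν, ∑ i, ⟪b i, v⟫ * (⟪b i, v⟫ * fderiv ℝ g v (b j)
        - ⟪b j, v⟫ * fderiv ℝ g v (b i))
          = r ^ 2 * fderiv ℝ g v (b j) - ⟪b j, v⟫ * fderiv ℝ g v v := by
      filter_upwards [hr] with v hv
      have e1 : r ^ 2 = ∑ i, ⟪b i, v⟫ ^ 2 := by rw [b.sum_sq_inner_right, hv]
      have e2 : fderiv ℝ g v v = ∑ i, ⟪b i, v⟫ * fderiv ℝ g v (b i) :=
        apply_eq_sum_inner b _ v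
      rw [e1, e2, Finset.sum_mul, Finset.mul_sum, ← Finset.sum_sub_distrib]
      exact Finset.sum_congr rfl fun i _ => by ring
    rw [integral_congr_ae hpt, integral_sub (hint (by fun_prop)) (hint (by fun_prop)),
      integral_const_mul, hcount] at hsum
    linarith
  -- both sides are linear in `u`
  have hu : u = ∑ j, ⟪b j, u⟫ • b j := (b.sum_repr' u).symm
  have lin : ∀ h : E → ℝ, Continuous h →
      ∫ v, ⟪u, v⟫ * h v ∂ν = ∑ j, ⟪b j, u⟫ * ∫ v, ⟪b j, v⟫ * h v ∂ν := fun h hh => by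
    simp_rw [← integral_const_mul]
    rw [← integral_finsetSum _ (fun i _ => hint (by fun_prop))]
    congr 1 with v
    conv_lhs => rw [hu, sum_inner, Finset.sum_mul]
    exact Finset.sum_congr rfl fun j _ => by rw [real_inner_smul_left, mul_assoc]
  have lin' : ∫ v, fderiv ℝ g v u ∂ν = ∑ j, ⟪b j, u⟫ * ∫ v, fderiv ℝ g v (b j) ∂ν := by
    simp_rw [← integral_const_mul]
    rw [← integral_finsetSum _ (fun i _ => hint (by fun_prop))]
    congr 1 with v
    conv_lhs => rw [hu]
    simp only [map_sum, map_smul, smul_eq_mul]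
  rw [lin g hgc, lin' , lin (fun v => fderiv ℝ g v v) (by fun_prop), Finset.mul_sum,
    Finset.mul_sum, ← Finset.sum_sub_distrib]
  refine Finset.sum_congr rfl fun j _ => ?_
  linear_combination ⟪b j, u⟫ * hbasis j

theorem integral_inner_sq_sphere [IsProbabilityMeasure ν]
    (hν : ∀ R : E ≃ₗᵢ[ℝ] E, MeasurePreserving R ν ν) (hr : ∀ᵐ v ∂ν, ‖v‖ = r) (u : E) :
    (Module.finrank ℝ E : ℝ) * ∫ v, ⟪u, v⟫ ^ 2 ∂ν = r ^ 2 * ‖u‖ ^ 2 := by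
  have h := integral_inner_mul_sphere hν hr (g := fun v => ⟪u, v⟫) (innerSL ℝ u).contDiff u
  have hd : ∀ v, fderiv ℝ (fun v => ⟪u, v⟫) v = innerSL ℝ u := fun v =>
    (innerSL ℝ u).hasFDerivAt.fderiv
  simp only [hd, innerSL_apply_apply, integral_const, probReal_univ, one_smul,
    real_inner_self_eq_norm_sq, ← sq] at h
  linarith

/-! ### Projections of rotation-invariant measures -/

variable {F : Type*} [NormedAddCommGroup F] [InnerProductSpace ℝ F] [FiniteDimensional ℝ F]

theorem integral_norm_sq_proj_sphere [IsProbabilityMeasure ν]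
    (hν : ∀ R : E ≃ₗᵢ[ℝ] E, MeasurePreserving R ν ν) (hr : ∀ᵐ v ∂ν, ‖v‖ = r)
    {π : E →L[ℝ] F} (hπ : ∀ y, π (ContinuousLinearMap.adjoint π y) = y) :
    (Module.finrank ℝ E : ℝ) * ∫ v, ‖π v‖ ^ 2 ∂ν = r ^ 2 * Module.finrank ℝ F := by
  let e := stdOrthonormalBasis ℝ F
  have h : ∀ v, ‖π v‖ ^ 2 = ∑ j, ⟪ContinuousLinearMap.adjoint π (e j), v⟫ ^ 2 := fun v => by
    simp_rw [ContinuousLinearMap.adjoint_inner_left, e.sum_sq_inner_right]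
  simp_rw [h]
  rw [integral_finsetSum _ (fun j _ => integrable_of_continuous_of_norm_eq hr (by fun_prop)),
    Finset.mul_sum]
  have h1 : ∀ j, ‖ContinuousLinearMap.adjoint π (e j)‖ ^ 2 = 1 := fun j => by
    rw [← real_inner_self_eq_norm_sq, ContinuousLinearMap.adjoint_inner_left, hπ]
    simp
  simp [integral_inner_sq_sphere hν hr, h1, mul_comm]

/-- The spherical integration by parts for a function of `Y = s π v + y₀`: the trace of the second
derivative of `f` at `Y` replaces the radial term. This is the generator identity behind Stein's
method for projections of the sphere. -/
theorem integral_fderiv_proj_sphere [IsFiniteMeasure ν]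
    (hν : ∀ R : E ≃ₗᵢ[ℝ] E, MeasurePreserving R ν ν) (hr : ∀ᵐ v ∂ν, ‖v‖ = r)
    {π : E →L[ℝ] F} (hπ : ∀ y, π (ContinuousLinearMap.adjoint π y) = y)
    {f : F → ℝ} (hf : ContDiff ℝ 2 f) {ι : Type*} [Fintype ι] (e : OrthonormalBasis ι ℝ F)
    (s : ℝ) (y₀ : F) :
    ((Module.finrank ℝ E : ℝ) - 1) * ∫ v, fderiv ℝ f (s • π v + y₀) (π v) ∂ν
      = s * (r ^ 2 * ∫ v, ∑ j, fderiv ℝ (fderiv ℝ f) (s • π v + y₀) (e j) (e j) ∂ν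
        - ∫ v, fderiv ℝ (fderiv ℝ f) (s • π v + y₀) (π v) (π v) ∂ν) := by
  have hf1 : ContDiff ℝ 1 (fderiv ℝ f) := hf.fderiv_right (by norm_num)
  have hc1 := hf1.continuous
  have hc2 := hf1.continuous_fderiv (by norm_num)
  have hint : ∀ {h : E → ℝ}, Continuous h → Integrable h ν := fun h =>
    integrable_of_continuous_of_norm_eq hr h
  have hY : ContDiff ℝ 1 fun v => s • π v + y₀ := (π.contDiff.const_smul s).add contDiff_const
  have hd : ∀ j v h, fderiv ℝ (fun v => fderiv ℝ f (s • π v + y₀) (e j)) v h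
      = s * fderiv ℝ (fderiv ℝ f) (s • π v + y₀) (π h) (e j) := fun j v h => by
    have h1 : HasFDerivAt (fun v => s • π v + y₀) (s • π) v :=
      ((π.hasFDerivAt (x := v)).const_smul s).add_const y₀
    have h2 := (hf1.differentiable (by norm_num) (s • π v + y₀)).hasFDerivAt.comp v h1
    have h3 := h2.clm_apply (hasFDerivAt_const (e j) v)
    rw [HasFDerivAt.fderiv (f := fun v => fderiv ℝ f (s • π v + y₀) (e j)) h3]
    simp
  have hj : ∀ j, _ := fun j => integral_inner_mul_sphere hν hr
    (g := fun v => fderiv ℝ f (s • π v + y₀) (e j)) ((hf1.comp hY).clm_apply contDiff_const)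
    (ContinuousLinearMap.adjoint π (e j))
  simp only [hd, hπ, ContinuousLinearMap.adjoint_inner_left] at hj
  have s1 : ∫ v, fderiv ℝ f (s • π v + y₀) (π v) ∂ν
      = ∑ j, ∫ v, ⟪e j, π v⟫ * fderiv ℝ f (s • π v + y₀) (e j) ∂ν := by
    rw [← integral_finsetSum _ (fun j _ => hint (by fun_prop))]
    exact integral_congr_ae (Filter.Eventually.of_forall fun v => apply_eq_sum_inner e _ _)
  have s2 : s * ∫ v, fderiv ℝ (fderiv ℝ f) (s • π v + y₀) (π v) (π v) ∂ν
      = ∑ j, ∫ v, ⟪e j, π v⟫ * (s * fderiv ℝ (fderiv ℝ f) (s • π v + y₀) (π v) (e j)) ∂ν := by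
    rw [← integral_finsetSum _ (fun j _ => hint (by fun_prop)), ← integral_const_mul]
    refine integral_congr_ae (Filter.Eventually.of_forall fun v => ?_)
    simp only [apply_eq_sum_inner e (fderiv ℝ (fderiv ℝ f) (s • π v + y₀) (π v)) (π v),
      Finset.mul_sum]
    exact Finset.sum_congr rfl fun j _ => by ring
  rw [mul_sub, s2, s1, Finset.mul_sum, Finset.sum_congr rfl fun j _ => hj j,
    Finset.sum_sub_distrib, integral_finsetSum _ (fun j _ => hint (by fun_prop))]
  simp_rw [integral_const_mul, Finset.mul_sum]
  congr 1
  exact Finset.sum_congr rfl fun j _ => by ring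

end Sphere

/-! ### Interpolation between the projected sphere and the Gaussian measure -/

section Interpolation

theorem norm_fderiv_le_one_of_abs_sub_le {F : Type*} [NormedAddCommGroup F] [NormedSpace ℝ F]
    {f : F → ℝ} (hLip : ∀ x y, |f x - f y| ≤ ‖x - y‖) (y : F) :
    ‖fderiv ℝ f y‖ ≤ 1 :=
  norm_fderiv_le_of_lip' ℝ zero_le_one
    (Filter.Eventually.of_forall fun x => by simpa using hLip x y)

theorem norm_proj_le {E F : Type*} [NormedAddCommGroup E] [InnerProductSpace ℝ E]
    [FiniteDimensional ℝ E] [NormedAddCommGroup F] [InnerProductSpace ℝ F] [FiniteDimensional ℝ F]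
    {π : E →L[ℝ] F} (hπ : ∀ y, π (ContinuousLinearMap.adjoint π y) = y) (v : E) : ‖π v‖ ≤ ‖v‖ := by
  have h : ‖ContinuousLinearMap.adjoint π (π v)‖ = ‖π v‖ := by
    rw [← sq_eq_sq₀ (norm_nonneg _) (norm_nonneg _), ← real_inner_self_eq_norm_sq,
      ContinuousLinearMap.adjoint_inner_left, hπ, real_inner_self_eq_norm_sq]
  rcases (norm_nonneg (π v)).eq_or_lt with h0 | h0
  · rw [← h0]; positivity
  have h1 := real_inner_le_norm (ContinuousLinearMap.adjoint π (π v)) v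
  rw [ContinuousLinearMap.adjoint_inner_left, real_inner_self_eq_norm_mul_norm, h] at h1
  exact le_of_mul_le_mul_left h1 h0
variable {F : Type*} [NormedAddCommGroup F] [InnerProductSpace ℝ F] [FiniteDimensional ℝ F]
  [MeasurableSpace F] [BorelSpace F]

theorem integral_inner_mul_fderiv_stdGaussian {f : F → ℝ} (hf : ContDiff ℝ 2 f)
    (hLip : ∀ x y, |f x - f y| ≤ ‖x - y‖) {C : ℝ} (hC : ∀ y, ‖fderiv ℝ (fderiv ℝ f) y‖ ≤ C)
    (y₀ : F) (c : ℝ) (v w : F) :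
    ∫ z, ⟪w, z⟫ * fderiv ℝ f (y₀ + c • z) v ∂stdGaussian F
      = c * ∫ z, fderiv ℝ (fderiv ℝ f) (y₀ + c • z) w v ∂stdGaussian F := by
  have hf1 : ContDiff ℝ 1 (fderiv ℝ f) := hf.fderiv_right (by norm_num)
  have hY : ContDiff ℝ 1 fun z : F => y₀ + c • z := contDiff_const.add (contDiff_id.const_smul c)
  have hd : ∀ z h, fderiv ℝ (fun z => fderiv ℝ f (y₀ + c • z) v) z h
      = c * fderiv ℝ (fderiv ℝ f) (y₀ + c • z) h v := fun z h => by
    have h1 : HasFDerivAt (fun z : F => y₀ + c • z) (c • ContinuousLinearMap.id ℝ F) z :=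
      ((hasFDerivAt_id z).const_smul c).const_add y₀
    have h2 := (hf1.differentiable (by norm_num) (y₀ + c • z)).hasFDerivAt.comp z h1
    have h3 := h2.clm_apply (hasFDerivAt_const v z)
    rw [HasFDerivAt.fderiv (f := fun z => fderiv ℝ f (y₀ + c • z) v) h3]
    simp
  rw [← integral_const_mul]
  simp_rw [← hd]
  refine integral_inner_mul_stdGaussian ((hf1.comp hY).clm_apply contDiff_const)
    (C₀ := ‖v‖) (C₁ := |c| * (C * ‖v‖)) (fun z => ?_) (fun z => ?_) w
  · simpa using (fderiv ℝ f (y₀ + c • z)).le_of_opNorm_le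
      (norm_fderiv_le_one_of_abs_sub_le hLip _) v
  · have hC₀ : 0 ≤ C := (norm_nonneg (fderiv ℝ (fderiv ℝ f) 0)).trans (hC 0)
    refine ContinuousLinearMap.opNorm_le_bound _ (by positivity) fun h => ?_
    refine (congrArg norm (hd z h)).trans_le ?_
    rw [norm_mul, Real.norm_eq_abs, mul_assoc]
    gcongr
    calc _ ≤ ‖fderiv ℝ (fderiv ℝ f) (y₀ + c • z)‖ * ‖h‖ * ‖v‖ :=
          ContinuousLinearMap.le_opNorm₂ _ _ _
      _ ≤ C * ‖h‖ * ‖v‖ := by gcongr; exact hC _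
      _ = _ := by ring

theorem integral_fderiv_self_stdGaussian {f : F → ℝ} (hf : ContDiff ℝ 2 f)
    (hLip : ∀ x y, |f x - f y| ≤ ‖x - y‖) {C : ℝ} (hC : ∀ y, ‖fderiv ℝ (fderiv ℝ f) y‖ ≤ C)
    {ι : Type*} [Fintype ι] (e : OrthonormalBasis ι ℝ F) (y₀ : F) (c : ℝ) :
    ∫ z, fderiv ℝ f (y₀ + c • z) z ∂stdGaussian F
      = c * ∫ z, ∑ j, fderiv ℝ (fderiv ℝ f) (y₀ + c • z) (e j) (e j) ∂stdGaussian F := by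
  have hf1 : ContDiff ℝ 1 (fderiv ℝ f) := hf.fderiv_right (by norm_num)
  have hc1 := hf1.continuous
  have hc2 := hf1.continuous_fderiv (by norm_num)
  rw [integral_finsetSum, Finset.mul_sum,
    ← Finset.sum_congr rfl fun j _ =>
      integral_inner_mul_fderiv_stdGaussian hf hLip hC y₀ c (e j) (e j), ← integral_finsetSum]
  · exact integral_congr_ae (Filter.Eventually.of_forall fun z => apply_eq_sum_inner e _ z)
  · intro j _
    refine integrable_norm_stdGaussian.mono' (Continuous.aestronglyMeasurable (by fun_prop))
      (Filter.Eventually.of_forall fun z => ?_)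
    have h1 : ‖⟪e j, z⟫‖ ≤ ‖z‖ := by simpa using norm_inner_le_norm (𝕜 := ℝ) (e j) z
    have h2 : ‖fderiv ℝ f (y₀ + c • z) (e j)‖ ≤ 1 := by
      simpa using (fderiv ℝ f (y₀ + c • z)).le_of_opNorm_le
        (norm_fderiv_le_one_of_abs_sub_le hLip _) (e j)
    rw [norm_mul]
    exact (mul_le_mul h1 h2 (norm_nonneg _) (norm_nonneg _)).trans_eq (mul_one _)
  · intro j _
    refine (integrable_const C).mono' (Continuous.aestronglyMeasurable (by fun_prop))
      (Filter.Eventually.of_forall fun z => ?_)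
    refine (ContinuousLinearMap.le_opNorm₂ _ _ _).trans ?_
    simpa using hC (y₀ + c • z)

theorem integrable_prod_stdGaussian_of_le {E : Type*} [NormedAddCommGroup E] [MeasurableSpace E]
    [BorelSpace E] {ν : Measure E} [IsProbabilityMeasure ν] {r : ℝ} (hr : ∀ᵐ v ∂ν, ‖v‖ = r) {h : E × F → ℝ} (hc : Continuous h) {A B : ℝ} (hle : ∀ p : E × F, ‖p.1‖ = r → ‖h p‖ ≤ A + B * ‖p.2‖) :
    Integrable h (ν.prod (stdGaussian F)) :=
  ((integrable_const A).add ((integrable_norm_stdGaussian.comp_snd ν).const_mul B)).mono'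
    hc.aestronglyMeasurable
    ((Measure.quasiMeasurePreserving_fst.ae hr).mono fun p hp => hle p hp)

variable {E : Type*} [NormedAddCommGroup E] [InnerProductSpace ℝ E] [FiniteDimensional ℝ E]
  [MeasurableSpace E] [BorelSpace E] {ν : Measure E} [IsProbabilityMeasure ν] {r : ℝ}

/-- The integration by parts for `Y = s π v + c z`. The spherical formula expresses
`𝔼 Df(Y)(π v)` by `𝔼 Δf(Y)` and `𝔼 D²f(Y)(π v, π v)`; after multiplication by `c`, Gaussian
integration by parts turns these back into first derivatives of `f`, so that the second derivatives,
for which a Lipschitz bound gives no control, do not occur in the result. -/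
theorem integral_fderiv_interpolation (hν : ∀ R : E ≃ₗᵢ[ℝ] E, MeasurePreserving R ν ν)
    (hr : ∀ᵐ v ∂ν, ‖v‖ = r) {π : E →L[ℝ] F} (hπ : ∀ y, π (ContinuousLinearMap.adjoint π y) = y)
    {f : F → ℝ} (hf : ContDiff ℝ 2 f) (hLip : ∀ x y, |f x - f y| ≤ ‖x - y‖)
    {C : ℝ} (hC : ∀ y, ‖fderiv ℝ (fderiv ℝ f) y‖ ≤ C) (s c : ℝ) :
    c * ((Module.finrank ℝ E : ℝ) - 1) *
        ∫ p : E × F, fderiv ℝ f (s • π p.1 + c • p.2) (π p.1) ∂ν.prod (stdGaussian F)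
      = s * (r ^ 2 * ∫ p : E × F, fderiv ℝ f (s • π p.1 + c • p.2) p.2 ∂ν.prod (stdGaussian F)
        - ∫ p : E × F, ⟪π p.1, p.2⟫ * fderiv ℝ f (s • π p.1 + c • p.2) (π p.1)
            ∂ν.prod (stdGaussian F)) := by
  have hf1 : ContDiff ℝ 1 (fderiv ℝ f) := hf.fderiv_right (by norm_num)
  have hc1 := hf1.continuous
  have hc2 := hf1.continuous_fderiv (by norm_num)
  have hC₀ : 0 ≤ C := (norm_nonneg (fderiv ℝ (fderiv ℝ f) 0)).trans (hC 0)
  let e := stdOrthonormalBasis ℝ F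
  have hD : ∀ y h, ‖fderiv ℝ f y h‖ ≤ ‖h‖ := fun y h => by
    simpa using (fderiv ℝ f y).le_of_opNorm_le (norm_fderiv_le_one_of_abs_sub_le hLip y) h
  have hDD : ∀ y h h', ‖fderiv ℝ (fderiv ℝ f) y h h'‖ ≤ C * ‖h‖ * ‖h'‖ := fun y h h' =>
    (ContinuousLinearMap.le_opNorm₂ _ _ _).trans (by gcongr; exact hC _)
  have hint : ∀ {h : E × F → ℝ} {A B : ℝ}, Continuous h →
      (∀ p : E × F, ‖p.1‖ = r → ‖h p‖ ≤ A + B * ‖p.2‖) → Integrable h (ν.prod (stdGaussian F)) :=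
    fun hc hle => integrable_prod_stdGaussian_of_le hr hc hle
  have iA : Integrable (fun p : E × F => fderiv ℝ f (s • π p.1 + c • p.2) (π p.1))
      (ν.prod (stdGaussian F)) := hint (A := r) (B := 0) (by fun_prop) fun p hp => by
    simpa using (hD _ _).trans ((norm_proj_le hπ _).trans_eq hp)
  have iB : Integrable (fun p : E × F => fderiv ℝ f (s • π p.1 + c • p.2) p.2)
      (ν.prod (stdGaussian F)) := hint (A := 0) (B := 1) (by fun_prop) fun p hp => by
    simpa using hD _ _
  have iM : Integrable (fun p : E × F => ⟪π p.1, p.2⟫ * fderiv ℝ f (s • π p.1 + c • p.2) (π p.1))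
      (ν.prod (stdGaussian F)) := hint (A := 0) (B := r ^ 2) (by fun_prop) fun p hp => by
    have h1 := (norm_proj_le hπ p.1).trans_eq hp
    have hr0 : 0 ≤ r := hp ▸ norm_nonneg _
    rw [norm_mul, zero_add]
    calc _ ≤ (r * ‖p.2‖) * r := mul_le_mul ((norm_inner_le_norm _ _).trans (by gcongr))
          ((hD _ _).trans h1) (norm_nonneg _) (by positivity)
      _ = _ := by ring
  have iP : Integrable (fun p : E × F =>
      ∑ j, fderiv ℝ (fderiv ℝ f) (s • π p.1 + c • p.2) (e j) (e j)) (ν.prod (stdGaussian F)) :=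
    integrable_finsetSum _ fun j _ => hint (A := C) (B := 0) (by fun_prop) fun p _ => by
      simpa using hDD (s • π p.1 + c • p.2) (e j) (e j)
  have iQ : Integrable (fun p : E × F =>
      fderiv ℝ (fderiv ℝ f) (s • π p.1 + c • p.2) (π p.1) (π p.1)) (ν.prod (stdGaussian F)) :=
    hint (A := C * r * r) (B := 0) (by fun_prop) fun p hp => by
      have h1 := (norm_proj_le hπ p.1).trans_eq hp
      have hr0 : 0 ≤ r := hp ▸ norm_nonneg _
      simpa using (hDD _ _ _).trans
        (mul_le_mul (mul_le_mul_of_nonneg_left h1 hC₀) h1 (norm_nonneg _) (by positivity))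
  have eA : ((Module.finrank ℝ E : ℝ) - 1) *
        ∫ p : E × F, fderiv ℝ f (s • π p.1 + c • p.2) (π p.1) ∂ν.prod (stdGaussian F)
      = s * (r ^ 2 * ∫ p : E × F, ∑ j, fderiv ℝ (fderiv ℝ f) (s • π p.1 + c • p.2) (e j) (e j)
            ∂ν.prod (stdGaussian F)
        - ∫ p : E × F, fderiv ℝ (fderiv ℝ f) (s • π p.1 + c • p.2) (π p.1) (π p.1)
            ∂ν.prod (stdGaussian F)) := by
    rw [integral_prod_symm _ iA, integral_prod_symm _ iP, integral_prod_symm _ iQ,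
      ← integral_const_mul, ← integral_const_mul,
      ← integral_sub (iP.integral_prod_right.const_mul _) iQ.integral_prod_right,
      ← integral_const_mul]
    exact integral_congr_ae (Filter.Eventually.of_forall fun z =>
      integral_fderiv_proj_sphere hν hr hπ hf e s (c • z))
  have eB : ∫ p : E × F, fderiv ℝ f (s • π p.1 + c • p.2) p.2 ∂ν.prod (stdGaussian F)
      = c * ∫ p : E × F, ∑ j, fderiv ℝ (fderiv ℝ f) (s • π p.1 + c • p.2) (e j) (e j)
            ∂ν.prod (stdGaussian F) := by
    rw [integral_prod _ iB, integral_prod _ iP, ← integral_const_mul]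
    exact integral_congr_ae (Filter.Eventually.of_forall fun v =>
      integral_fderiv_self_stdGaussian hf hLip hC e (s • π v) c)
  have eM : ∫ p : E × F, ⟪π p.1, p.2⟫ * fderiv ℝ f (s • π p.1 + c • p.2) (π p.1)
        ∂ν.prod (stdGaussian F)
      = c * ∫ p : E × F, fderiv ℝ (fderiv ℝ f) (s • π p.1 + c • p.2) (π p.1) (π p.1)
            ∂ν.prod (stdGaussian F) := by
    rw [integral_prod _ iM, integral_prod _ iQ, ← integral_const_mul]
    exact integral_congr_ae (Filter.Eventually.of_forall fun v =>
      integral_inner_mul_fderiv_stdGaussian hf hLip hC (s • π v) c (π v) (π v))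
  rw [eB, eM]
  linear_combination c * eA

/-- The comparison for smooth test functions: `f (π v)` and `f (σ z)` are the endpoints of
`α ↦ 𝔼 f (sin α π v + σ cos α z)`, whose derivative is bounded by a multiple of `sin α`. -/
theorem abs_integral_proj_sub_integral_stdGaussian_le_of_contDiff
    (hν : ∀ R : E ≃ₗᵢ[ℝ] E, MeasurePreserving R ν ν)
    (hr : ∀ᵐ v ∂ν, ‖v‖ = r) {π : E →L[ℝ] F} (hπ : ∀ y, π (ContinuousLinearMap.adjoint π y) = y)
    (hdim : 2 ≤ Module.finrank ℝ E) {f : F → ℝ} (hf : ContDiff ℝ 2 f)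
    (hLip : ∀ x y, |f x - f y| ≤ ‖x - y‖) {C : ℝ} (hC : ∀ y, ‖fderiv ℝ (fderiv ℝ f) y‖ ≤ C)
    {σ : ℝ} (hσ : 0 < σ) :
    |∫ v, f (π v) ∂ν - ∫ z, f (σ • z) ∂stdGaussian F| ≤
      (|r ^ 2 - σ ^ 2 * ((Module.finrank ℝ E : ℝ) - 1)| * √(Module.finrank ℝ F)
        + r ^ 2 * Module.finrank ℝ F / Module.finrank ℝ E)
        / (σ * ((Module.finrank ℝ E : ℝ) - 1)) := by
  set d : ℝ := (Module.finrank ℝ E : ℝ) with hd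
  have hd2 : 2 ≤ d := by rw [hd]; exact_mod_cast hdim
  set k : ℝ := (Module.finrank ℝ F : ℝ) with hk
  set M := (|r ^ 2 - σ ^ 2 * (d - 1)| * √k + r ^ 2 * k / d) / (σ * (d - 1)) with hM
  have hf1 : ContDiff ℝ 1 (fderiv ℝ f) := hf.fderiv_right (by norm_num)
  have hc1 := hf1.continuous
  have hc := hf.continuous
  have hD : ∀ y h, ‖fderiv ℝ f y h‖ ≤ ‖h‖ := fun y h => by
    simpa using (fderiv ℝ f y).le_of_opNorm_le (norm_fderiv_le_one_of_abs_sub_le hLip y) h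
  have hsin : ∀ a : ℝ, ‖Real.sin a‖ ≤ 1 := Real.abs_sin_le_one
  have hcos : ∀ a : ℝ, ‖Real.cos a‖ ≤ 1 := Real.abs_cos_le_one
  -- norms of the interpolation and of its velocity
  have hnorm : ∀ (a b : ℝ) (p : E × F), ‖a‖ ≤ 1 → ‖b‖ ≤ 1 → ‖p.1‖ = r →
      ‖a • π p.1 + (σ * b) • p.2‖ ≤ r + σ * ‖p.2‖ := fun a b p ha hb hp => by
    refine (norm_add_le _ _).trans (add_le_add ?_ ?_)
    · rw [norm_smul]
      exact (mul_le_of_le_one_left (norm_nonneg _) ha).trans ((norm_proj_le hπ _).trans_eq hp)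
    · rw [norm_smul, norm_mul, Real.norm_of_nonneg hσ.le]
      gcongr
      exact mul_le_of_le_one_right hσ.le hb
  have hae : ∀ᵐ p : E × F ∂ν.prod (stdGaussian F), ‖p.1‖ = r :=
    Measure.quasiMeasurePreserving_fst.ae hr
  have hderiv : ∀ α : ℝ, HasDerivAt
      (fun α => ∫ p : E × F, f (Real.sin α • π p.1 + (σ * Real.cos α) • p.2)
        ∂ν.prod (stdGaussian F))
      (∫ p : E × F, fderiv ℝ f (Real.sin α • π p.1 + (σ * Real.cos α) • p.2)
        (Real.cos α • π p.1 + (σ * -Real.sin α) • p.2) ∂ν.prod (stdGaussian F)) α := fun α => by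
    refine (hasDerivAt_integral_of_dominated_loc_of_deriv_le (s := Set.univ)
      (bound := fun p : E × F => r + σ * ‖p.2‖)
      (F' := fun α (p : E × F) => fderiv ℝ f (Real.sin α • π p.1 + (σ * Real.cos α) • p.2)
        (Real.cos α • π p.1 + (σ * -Real.sin α) • p.2)) Filter.univ_mem
      (Filter.Eventually.of_forall fun a => Continuous.aestronglyMeasurable (by fun_prop))
      (integrable_prod_stdGaussian_of_le (A := |f 0| + r) (B := σ) hr (by fun_prop) ?_)
      (Continuous.aestronglyMeasurable (by fun_prop))
      (hae.mono fun p hp a _ => ?_)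
      ((integrable_const r).add ((integrable_norm_stdGaussian.comp_snd ν).const_mul σ))
      (Filter.Eventually.of_forall fun p a _ => ?_)).2
    · intro p hp
      have h1 := hLip (Real.sin α • π p.1 + (σ * Real.cos α) • p.2) 0
      rw [sub_zero] at h1
      have h2 := hnorm _ _ p (hsin α) (hcos α) hp
      have h3 := abs_sub_abs_le_abs_sub (f (Real.sin α • π p.1 + (σ * Real.cos α) • p.2)) (f 0)
      rw [Real.norm_eq_abs]
      linarith
    · exact (hD _ _).trans (hnorm _ _ p (hcos a) (by rw [norm_neg]; exact hsin a) hp)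
    · have h1 := ((Real.hasDerivAt_sin a).smul_const (π p.1)).add
        (((Real.hasDerivAt_cos a).const_mul σ).smul_const p.2)
      exact (hf.differentiable (by norm_num) _).hasFDerivAt.comp_hasDerivAt a h1
  -- integrability and size of the two integrals that control the derivative
  have iA : ∀ s c : ℝ, Integrable (fun p : E × F => fderiv ℝ f (s • π p.1 + c • p.2) (π p.1))
      (ν.prod (stdGaussian F)) := fun s c =>
    integrable_prod_stdGaussian_of_le (A := r) (B := 0) hr (by fun_prop) fun p hp => by
      simpa using (hD _ _).trans ((norm_proj_le hπ _).trans_eq hp)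
  have iB : ∀ s c : ℝ, Integrable (fun p : E × F => fderiv ℝ f (s • π p.1 + c • p.2) p.2)
      (ν.prod (stdGaussian F)) := fun s c =>
    integrable_prod_stdGaussian_of_le (A := 0) (B := 1) hr (by fun_prop) fun p hp => by
      simpa using hD _ _
  have bB : ∀ s c : ℝ, |∫ p : E × F, fderiv ℝ f (s • π p.1 + c • p.2) p.2 ∂ν.prod (stdGaussian F)|
      ≤ √k := fun s c => by
    have h1 := norm_integral_le_of_norm_le (integrable_norm_stdGaussian.comp_snd ν)
      (Filter.Eventually.of_forall fun p : E × F => hD (s • π p.1 + c • p.2) p.2)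
    rw [integral_fun_snd (fun z : F => ‖z‖), probReal_univ, one_smul] at h1
    exact h1.trans integral_norm_stdGaussian_le
  have bM : ∀ s c : ℝ, |∫ p : E × F, ⟪π p.1, p.2⟫ * fderiv ℝ f (s • π p.1 + c • p.2) (π p.1)
      ∂ν.prod (stdGaussian F)| ≤ r ^ 2 * k / d := fun s c => by
    have i1 : Integrable (fun p : E × F => |⟪π p.1, p.2⟫| * ‖π p.1‖) (ν.prod (stdGaussian F)) :=
      integrable_prod_stdGaussian_of_le (A := 0) (B := r ^ 2) hr (by fun_prop) fun p hp => by
        have h1 := (norm_proj_le hπ p.1).trans_eq hp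
        have hr0 : 0 ≤ r := hp ▸ norm_nonneg _
        rw [norm_mul, norm_norm, Real.norm_eq_abs, abs_abs, zero_add]
        calc _ ≤ (r * ‖p.2‖) * r := mul_le_mul ((abs_real_inner_le_norm _ _).trans (by gcongr))
              h1 (norm_nonneg _) (by positivity)
          _ = _ := by ring
    have h1 := norm_integral_le_of_norm_le i1 (Filter.Eventually.of_forall fun p : E × F =>
      show ‖⟪π p.1, p.2⟫ * fderiv ℝ f (s • π p.1 + c • p.2) (π p.1)‖ ≤ _ by
        rw [norm_mul]; exact mul_le_mul_of_nonneg_left (hD _ _) (norm_nonneg _))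
    refine h1.trans ?_
    have h2 : ∫ p : E × F, |⟪π p.1, p.2⟫| * ‖π p.1‖ ∂ν.prod (stdGaussian F)
        ≤ ∫ v, ‖π v‖ ^ 2 ∂ν := by
      rw [integral_prod _ i1]
      refine integral_mono i1.integral_prod_left
        (integrable_of_continuous_of_norm_eq hr (by fun_prop)) fun v => ?_
      simp only [integral_mul_const, sq]
      exact mul_le_mul_of_nonneg_right (integral_abs_inner_stdGaussian_le _) (norm_nonneg _)
    refine h2.trans (le_of_eq ?_)
    rw [eq_div_iff (by positivity), mul_comm]
    exact integral_norm_sq_proj_sphere hν hr hπ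
  have hbound : ∀ α ∈ Set.Ico (0 : ℝ) (Real.pi / 2),
      ‖∫ p : E × F, fderiv ℝ f (Real.sin α • π p.1 + (σ * Real.cos α) • p.2)
        (Real.cos α • π p.1 + (σ * -Real.sin α) • p.2) ∂ν.prod (stdGaussian F)‖
          ≤ M * Real.sin α := by
    intro α hα
    have hs : 0 ≤ Real.sin α :=
      Real.sin_nonneg_of_nonneg_of_le_pi hα.1 (by linarith [hα.2, Real.pi_pos])
    have key := integral_fderiv_interpolation hν hr hπ hf hLip hC (Real.sin α) (σ * Real.cos α)
    have hb := bB (Real.sin α) (σ * Real.cos α)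
    have hm := bM (Real.sin α) (σ * Real.cos α)
    simp only [map_add, map_smul, smul_eq_mul]
    rw [integral_add ((iA _ _).const_mul _) ((iB _ _).const_mul _), integral_const_mul,
      integral_const_mul]
    set a := ∫ p : E × F, fderiv ℝ f (Real.sin α • π p.1 + (σ * Real.cos α) • p.2) (π p.1)
      ∂ν.prod (stdGaussian F)
    set b := ∫ p : E × F, fderiv ℝ f (Real.sin α • π p.1 + (σ * Real.cos α) • p.2) p.2
      ∂ν.prod (stdGaussian F)
    set m := ∫ p : E × F, ⟪π p.1, p.2⟫ *
      fderiv ℝ f (Real.sin α • π p.1 + (σ * Real.cos α) • p.2) (π p.1) ∂ν.prod (stdGaussian F)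
    have hpos : 0 < σ * (d - 1) := mul_pos hσ (by linarith)
    have heq : Real.cos α * a + σ * -Real.sin α * b
        = Real.sin α * ((r ^ 2 - σ ^ 2 * (d - 1)) * b - m) / (σ * (d - 1)) := by
      rw [eq_div_iff hpos.ne']
      linear_combination key
    rw [heq, hM, Real.norm_eq_abs, abs_div, abs_of_pos hpos, abs_mul, abs_of_nonneg hs,
      div_mul_eq_mul_div, mul_comm (Real.sin α)]
    gcongr
    refine (abs_sub _ _).trans (add_le_add ?_ hm)
    rw [abs_mul]
    gcongr
  have hGle := image_norm_le_of_norm_deriv_right_le_deriv_boundary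
    (f := fun α => (∫ p : E × F, f (Real.sin α • π p.1 + (σ * Real.cos α) • p.2)
        ∂ν.prod (stdGaussian F)) - ∫ z, f (σ • z) ∂stdGaussian F)
    (B := fun α => M * (1 - Real.cos α)) (B' := fun α => M * Real.sin α)
    (a := 0) (b := Real.pi / 2)
    (fun α _ => ((hderiv α).sub_const _).continuousAt.continuousWithinAt)
    (fun α _ => ((hderiv α).sub_const _).hasDerivWithinAt)
    (by
      simp only [Real.sin_zero, Real.cos_zero, zero_smul, zero_add, mul_one, sub_self, mul_zero]
      rw [integral_fun_snd (fun z : F => f (σ • z)), probReal_univ, one_smul, sub_self, norm_zero])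
    (fun α => by
      convert! ((Real.hasDerivAt_cos α).const_sub 1).const_mul M using 1
      simp) hbound
    (x := Real.pi / 2) ⟨by positivity, le_rfl⟩
  simp only [Real.sin_pi_div_two, Real.cos_pi_div_two, one_smul, mul_zero, zero_smul, add_zero,
    sub_zero, mul_one] at hGle
  rw [integral_fun_fst (fun v : E => f (π v)), probReal_univ, one_smul] at hGle
  exact hGle

end Interpolation

/-! ### Smoothing of Lipschitz functions -/

section Smoothing

variable {F : Type*} [NormedAddCommGroup F] [InnerProductSpace ℝ F] [FiniteDimensional ℝ F]
  [MeasurableSpace F] [BorelSpace F]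

theorem continuous_of_abs_sub_le {F : Type*} [NormedAddCommGroup F] {f : F → ℝ}
    (hLip : ∀ x y, |f x - f y| ≤ ‖x - y‖) : Continuous f :=
  (LipschitzWith.of_dist_le_mul (K := 1) fun x y => by
    simpa [dist_eq_norm] using hLip x y).continuous

/-- A `1`-Lipschitz function is a uniform limit of smooth `1`-Lipschitz functions with bounded
second derivatives, namely of its convolutions with bump functions. -/
theorem exists_contDiff_abs_sub_le {f : F → ℝ} (hLip : ∀ x y, |f x - f y| ≤ ‖x - y‖) {ε : ℝ}
    (hε : 0 < ε) : ∃ g : F → ℝ, ContDiff ℝ 2 g ∧ (∀ x y, |g x - g y| ≤ ‖x - y‖) ∧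
      (∃ C, ∀ y, ‖fderiv ℝ (fderiv ℝ g) y‖ ≤ C) ∧ ∀ x, |g x - f x| ≤ ε := by
  have hfc := continuous_of_abs_sub_le hLip
  obtain ⟨ψ, hψd, hψs, hψ0, hψ1, hψf⟩ : ∃ ψ : F → ℝ, ContDiff ℝ 2 ψ ∧ HasCompactSupport ψ ∧
      (∀ t, 0 ≤ ψ t) ∧ ∫ t, ψ t = 1 ∧
      ∀ x, dist (convolution ψ f (ContinuousLinearMap.lsmul ℝ ℝ) volume x) (f x) ≤ ε := by
    let φ : ContDiffBump (0 : F) := ⟨ε / 2, ε, by positivity, by linarith⟩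
    refine ⟨φ.normed volume, φ.contDiff_normed, φ.hasCompactSupport_normed, φ.nonneg_normed,
      φ.integral_normed, fun x => φ.dist_normed_convolution_le hfc.aestronglyMeasurable ?_⟩
    intro y hy
    rw [Real.dist_eq]
    exact (hLip y x).trans (by simpa [dist_eq_norm] using (Metric.mem_ball.1 hy).le)
  have hψc := hψd.continuous
  have hD : Continuous (fderiv ℝ ψ) := hψd.continuous_fderiv (by norm_num)
  have hDs : HasCompactSupport (fderiv ℝ ψ) := hψs.fderiv ℝ
  let L := ContinuousLinearMap.lsmul ℝ ℝ (E := ℝ)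
  let g : F → ℝ := convolution ψ f L volume
  have hg : ∀ x, g x = ∫ t, ψ t * f (x - t) := fun x => rfl
  have hg' : ∀ x, fderiv ℝ g x = ∫ t, f (x - t) • fderiv ℝ ψ t := fun x => by
    rw [(hψs.hasFDerivAt_convolution_left L (hψd.of_le (by norm_num))
      hfc.locallyIntegrable x).fderiv]
    refine integral_congr_ae (Filter.Eventually.of_forall fun t => ?_)
    ext h
    simp [L, ContinuousLinearMap.precompL_apply, mul_comm]
  refine ⟨g, hψs.contDiff_convolution_left (n := 2) L hψd hfc.locallyIntegrable, fun x y => ?_,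
    ⟨∫ t, ‖fderiv ℝ ψ t‖, fun y => ?_⟩, fun x => ?_⟩
  · have hi : ∀ x, Integrable fun t => ψ t * f (x - t) := fun x =>
      Continuous.integrable_of_hasCompactSupport (by fun_prop) hψs.mul_right
    rw [hg, hg, ← integral_sub (hi x) (hi y), ← Real.norm_eq_abs]
    calc _ ≤ ∫ t, ψ t * ‖x - y‖ := by
          refine norm_integral_le_of_norm_le
            ((hψc.integrable_of_hasCompactSupport hψs).mul_const _)
            (Filter.Eventually.of_forall fun t => ?_)
          rw [← mul_sub, norm_mul, Real.norm_of_nonneg (hψ0 t)]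
          refine mul_le_mul_of_nonneg_left ?_ (hψ0 t)
          simpa using hLip (x - t) (y - t)
      _ = ‖x - y‖ := by rw [integral_mul_const, hψ1, one_mul]
  · refine norm_fderiv_le_of_lip' ℝ (integral_nonneg fun t => norm_nonneg _)
      (Filter.Eventually.of_forall fun x => ?_)
    have hi : ∀ x, Integrable fun t => f (x - t) • fderiv ℝ ψ t := fun x =>
      Continuous.integrable_of_hasCompactSupport (by fun_prop)
        (hDs.mono fun t ht h => ht (by simp [h]))
    rw [hg', hg', ← integral_sub (hi x) (hi y), ← integral_mul_const]
    refine norm_integral_le_of_norm_le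
      ((hD.norm.integrable_of_hasCompactSupport hDs.norm).mul_const _)
      (Filter.Eventually.of_forall fun t => ?_)
    rw [← sub_smul, norm_smul, mul_comm]
    gcongr
    simpa using hLip (x - t) (y - t)
  · rw [← Real.dist_eq]
    exact hψf x

theorem abs_integral_sub_le_of_abs_sub_le {α : Type*} [MeasurableSpace α] {μ : Measure α}
    [IsProbabilityMeasure μ] {f g : α → ℝ} (hf : Integrable f μ) (hg : Integrable g μ) {ε : ℝ}
    (h : ∀ a, |g a - f a| ≤ ε) : |∫ a, g a ∂μ - ∫ a, f a ∂μ| ≤ ε := by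
  rw [← integral_sub hg hf, ← Real.norm_eq_abs]
  simpa using norm_integral_le_of_norm_le_const (f := fun a => g a - f a) (μ := μ)
    (Filter.Eventually.of_forall h)

theorem integrable_comp_smul_stdGaussian {f : F → ℝ} (hLip : ∀ x y, |f x - f y| ≤ ‖x - y‖) (σ : ℝ) :
    Integrable (fun z => f (σ • z)) (stdGaussian F) := by
  have hc := continuous_of_abs_sub_le hLip
  refine ((integrable_const |f 0|).add (integrable_norm_stdGaussian.const_mul ‖σ‖)).mono'
    (Continuous.aestronglyMeasurable (by fun_prop)) (Filter.Eventually.of_forall fun z => ?_)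
  have h1 := hLip (σ • z) 0
  rw [sub_zero, norm_smul] at h1
  have h2 := abs_sub_abs_le_abs_sub (f (σ • z)) (f 0)
  simp only [Real.norm_eq_abs, Pi.add_apply] at h1 ⊢
  linarith

variable {E : Type*} [NormedAddCommGroup E] [InnerProductSpace ℝ E] [FiniteDimensional ℝ E]
  [MeasurableSpace E] [BorelSpace E] {ν : Measure E} [IsProbabilityMeasure ν] {r : ℝ}

/-- The projection of a rotation-invariant law on the sphere of radius `r` is close to a centred
Gaussian law, tested against `1`-Lipschitz functions. -/
theorem abs_integral_proj_sub_integral_stdGaussian_le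
    (hν : ∀ R : E ≃ₗᵢ[ℝ] E, MeasurePreserving R ν ν)
    (hr : ∀ᵐ v ∂ν, ‖v‖ = r) {π : E →L[ℝ] F} (hπ : ∀ y, π (ContinuousLinearMap.adjoint π y) = y)
    (hdim : 2 ≤ Module.finrank ℝ E) {f : F → ℝ} (hLip : ∀ x y, |f x - f y| ≤ ‖x - y‖)
    {σ : ℝ} (hσ : 0 < σ) :
    |∫ v, f (π v) ∂ν - ∫ z, f (σ • z) ∂stdGaussian F| ≤
      (|r ^ 2 - σ ^ 2 * ((Module.finrank ℝ E : ℝ) - 1)| * √(Module.finrank ℝ F)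
        + r ^ 2 * Module.finrank ℝ F / Module.finrank ℝ E)
        / (σ * ((Module.finrank ℝ E : ℝ) - 1)) := by
  refine le_of_forall_pos_le_add fun ε hε => ?_
  obtain ⟨g, hg, hgLip, ⟨C, hC⟩, hgf⟩ := exists_contDiff_abs_sub_le hLip (half_pos hε)
  have h := abs_integral_proj_sub_integral_stdGaussian_le_of_contDiff hν hr hπ hdim hg hgLip hC hσ
  have hc := continuous_of_abs_sub_le hLip
  have hgc := hg.continuous
  have h1 := abs_integral_sub_le_of_abs_sub_le
    (integrable_of_continuous_of_norm_eq hr (g := fun v => f (π v)) (by fun_prop))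
    (integrable_of_continuous_of_norm_eq hr (g := fun v => g (π v)) (by fun_prop))
    fun v => hgf (π v)
  have h2 := abs_integral_sub_le_of_abs_sub_le (integrable_comp_smul_stdGaussian hLip σ)
    (integrable_comp_smul_stdGaussian hgLip σ) fun z => hgf (σ • z)
  rw [abs_le] at h h1 h2 ⊢
  constructor <;> linarith [h.1, h.2, h1.1, h1.2, h2.1, h2.2]

end Smoothing

/-! ### Haar-distributed rotations and frames -/

theorem measurePreserving_mul_right_orthogonalHaar {d : ℕ} (V : O d) :
    MeasurePreserving (· * V) (orthogonalHaar d) (orthogonalHaar d) := by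
  have : (orthogonalHaar d).IsHaarMeasure := by unfold orthogonalHaar; infer_instance
  have hm : Measurable fun U : O d => U * V := measurable_mul_const V
  have : IsProbabilityMeasure ((orthogonalHaar d).map (· * V)) :=
    Measure.isProbabilityMeasure_map hm.aemeasurable
  -- right translates of a left Haar probability measure are left Haar probability measures
  exact ⟨hm, Measure.isHaarMeasure_eq_of_isProbabilityMeasure _ _⟩

/-- The transposed action `v ↦ Uᵀ v` of `O(d)`: for a Haar-distributed `U`, the vector `Uᵀ v` is
uniformly distributed on the sphere of radius `‖v‖`. -/
noncomputable def rotTranspose {d : ℕ} (U : O d) (v : EuclideanSpace ℝ (Fin d)) :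
    EuclideanSpace ℝ (Fin d) :=
  WithLp.toLp 2 (U.1.transpose.mulVec v.ofLp)

theorem inner_rot_right {d : ℕ} (U : O d) (v w : EuclideanSpace ℝ (Fin d)) :
    ⟪v, rot U w⟫ = ⟪rotTranspose U v, w⟫ := by
  simp only [rot, rotTranspose, EuclideanSpace.inner_eq_star_dotProduct, star_trivial]
  rw [dotProduct_comm, Matrix.dotProduct_mulVec, dotProduct_comm, Matrix.mulVec_transpose]

theorem norm_rotTranspose {d : ℕ} (U : O d) (v : EuclideanSpace ℝ (Fin d)) :
    ‖rotTranspose U v‖ = ‖v‖ := by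
  have h : rot U (rotTranspose U v) = v := by
    have hU : U.1 * U.1.transpose = 1 := (Matrix.mem_unitaryGroup_iff (A := U.1)).mp U.2
    simp [rot, rotTranspose, hU]
  rw [← sq_eq_sq₀ (norm_nonneg _) (norm_nonneg _), ← real_inner_self_eq_norm_sq,
    ← inner_rot_right, h, real_inner_self_eq_norm_sq]

theorem continuous_rotTranspose {d : ℕ} (v : EuclideanSpace ℝ (Fin d)) :
    Continuous fun U : O d => rotTranspose U v :=
  (PiLp.continuous_toLp 2 _).comp
    (Continuous.matrix_mulVec (continuous_subtype_val.matrix_transpose) continuous_const)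

theorem exists_rotTranspose_mul_eq {d : ℕ}
    (R : EuclideanSpace ℝ (Fin d) ≃ₗᵢ[ℝ] EuclideanSpace ℝ (Fin d)) :
    ∃ V : O d, ∀ U v, rotTranspose (U * V) v = R (rotTranspose U v) := by
  let b := EuclideanSpace.basisFun (Fin d) ℝ
  let M : O d := ⟨_, R.toMatrix_mem_unitaryGroup b b⟩
  have hM : ∀ v, M.1.mulVec v.ofLp = (R v).ofLp := fun v =>
    LinearMap.toMatrix_mulVec_repr b.toBasis b.toBasis R.toLinearEquiv.toLinearMap v
  refine ⟨star M, fun U v => ?_⟩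
  have hV : (U * star M).1.transpose = M.1 * U.1.transpose := by
    simp [Matrix.star_eq_conjTranspose]
  simp only [rotTranspose, hV]
  rw [← Matrix.mulVec_mulVec]
  exact congrArg (WithLp.toLp 2) (hM (WithLp.toLp 2 _))

theorem measurePreserving_map_rotTranspose {d : ℕ} (x : EuclideanSpace ℝ (Fin d))
    (R : EuclideanSpace ℝ (Fin d) ≃ₗᵢ[ℝ] EuclideanSpace ℝ (Fin d)) :
    MeasurePreserving R ((orthogonalHaar d).map fun U => rotTranspose U x)
      ((orthogonalHaar d).map fun U => rotTranspose U x) := by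
  obtain ⟨V, hV⟩ := exists_rotTranspose_mul_eq R
  have hm := (continuous_rotTranspose x).measurable
  refine ⟨R.continuous.measurable, ?_⟩
  rw [Measure.map_map R.continuous.measurable hm]
  conv_rhs => rw [← (measurePreserving_mul_right_orthogonalHaar V).map_eq]
  rw [Measure.map_map hm (measurable_mul_const V)]
  congr 1
  funext U
  exact (hV U x).symm

/-- The projection of `ℝ^d` onto its first `k` coordinates. -/
noncomputable def firstCoords {d k : ℕ} (hk : k ≤ d) :
    EuclideanSpace ℝ (Fin d) →L[ℝ] EuclideanSpace ℝ (Fin k) :=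
  LinearMap.toContinuousLinearMap
    { toFun := fun v => WithLp.toLp 2 fun j => v (Fin.castLE hk j)
      map_add' := fun v w => by ext; simp
      map_smul' := fun c v => by ext; simp }

theorem firstCoords_apply {d k : ℕ} (hk : k ≤ d) (v : EuclideanSpace ℝ (Fin d)) (j : Fin k) :
    firstCoords hk v j = v (Fin.castLE hk j) := rfl

theorem firstCoords_adjoint {d k : ℕ} (hk : k ≤ d) (y : EuclideanSpace ℝ (Fin k)) :
    firstCoords hk (ContinuousLinearMap.adjoint (firstCoords hk) y) = y := by
  ext j
  have h : firstCoords hk (EuclideanSpace.single (Fin.castLE hk j) 1)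
      = EuclideanSpace.single j 1 := by
    ext i
    simp [firstCoords_apply]
  have h1 := ContinuousLinearMap.adjoint_inner_right (firstCoords hk)
    (EuclideanSpace.single (Fin.castLE hk j) 1) y
  rw [h] at h1
  simpa [EuclideanSpace.inner_single_left, firstCoords_apply] using h1

theorem proj_rotate_base {d k : ℕ} (hk : k ≤ d) (U : O d) (x : EuclideanSpace ℝ (Fin d)) :
    proj (Stiefel.rotate U (Stiefel.base hk)) x = firstCoords hk (rotTranspose U x) := by
  ext j
  change ⟪x, rot U (EuclideanSpace.single (Fin.castLE hk j) 1)⟫ = _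
  rw [inner_rot_right, firstCoords_apply]
  simp [EuclideanSpace.inner_single_right]

/-- The comparison for a single data point, projected along a Haar-distributed frame. -/
theorem abs_integral_stiefelHaar_sub_le {d k : ℕ} (hd : 2 ≤ d) (hk : k ≤ d)
    (x : EuclideanSpace ℝ (Fin d)) {σ : ℝ} (hσ : 0 < σ) {f : EuclideanSpace ℝ (Fin k) → ℝ}
    (hLip : ∀ x y, |f x - f y| ≤ ‖x - y‖) :
    |∫ θ, f (proj θ x) ∂stiefelHaar hk
        - ∫ z, f (σ • z) ∂stdGaussian (EuclideanSpace ℝ (Fin k))| ≤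
      (|‖x‖ ^ 2 - σ ^ 2 * ((d : ℝ) - 1)| * √k + ‖x‖ ^ 2 * k / d) / (σ * ((d : ℝ) - 1)) := by
  have hc := continuous_of_abs_sub_le hLip
  have hm := (continuous_rotTranspose x).measurable
  have : IsProbabilityMeasure ((orthogonalHaar d).map fun U => rotTranspose U x) :=
    Measure.isProbabilityMeasure_map hm.aemeasurable
  have h := abs_integral_proj_sub_integral_stdGaussian_le (r := ‖x‖)
    (measurePreserving_map_rotTranspose x)
    ((ae_map_iff hm.aemeasurable (measurableSet_eq_fun measurable_norm measurable_const)).2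
      (Filter.Eventually.of_forall fun U => norm_rotTranspose U x))
    (firstCoords_adjoint hk) (by simpa using hd) hLip hσ
  rw [integral_map hm.aemeasurable (Continuous.aestronglyMeasurable (by fun_prop))] at h
  have hm' : Measurable fun θ : Stiefel d k => f (proj θ x) :=
    hc.measurable.comp (measurable_proj x)
  rw [stiefelHaar, integral_map (measurable_rotate_left _).aemeasurable hm'.aestronglyMeasurable]
  simpa [proj_rotate_base] using h

theorem integrable_comp_proj_stiefelHaar {d k : ℕ} (hk : k ≤ d) (x : EuclideanSpace ℝ (Fin d))
    {f : EuclideanSpace ℝ (Fin k) → ℝ} (hc : Continuous f) :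
    Integrable (fun θ => f (proj θ x)) (stiefelHaar hk) := by
  have hm : Measurable fun θ : Stiefel d k => f (proj θ x) :=
    hc.measurable.comp (measurable_proj x)
  rw [stiefelHaar, integrable_map_measure hm.aestronglyMeasurable
    (measurable_rotate_left _).aemeasurable]
  have h : Continuous fun U : O d => f (firstCoords hk (rotTranspose U x)) :=
    hc.comp ((firstCoords hk).continuous.comp (continuous_rotTranspose x))
  simpa [Function.comp_def, proj_rotate_base] using
    (integrableOn_univ.1 (h.continuousOn.integrableOn_compact isCompact_univ) :
      Integrable _ (orthogonalHaar d))

/-! ### Averaging over the data -/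

theorem integral_projectedEmpirical {n d k : ℕ} (x : Fin n → EuclideanSpace ℝ (Fin d))
    {f : EuclideanSpace ℝ (Fin k) → ℝ} (θ : Stiefel d k) :
    ∫ y, f y ∂projectedEmpirical k x θ = (1 / (n : ℝ)) * ∑ i, f (proj θ (x i)) := by
  change ∫ y, f y ∂((n : ℝ≥0∞)⁻¹ • ∑ i, Measure.dirac (proj θ (x i))) = _
  rw [integral_smul_measure, integral_finsetSum_measure fun i _ => integrable_dirac (by simp)]
  simp

theorem integral_compProd_stiefelHaar {n d k : ℕ} (hn : 1 ≤ n) (hk : k ≤ d)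
    (x : Fin n → EuclideanSpace ℝ (Fin d)) {f : EuclideanSpace ℝ (Fin k) → ℝ}
    (hc : Continuous f) :
    ∫ p, f p.2 ∂(stiefelHaar hk).compProd (projectedEmpirical k x)
      = (1 / (n : ℝ)) * ∑ i, ∫ θ, f (proj θ (x i)) ∂stiefelHaar hk := by
  have := isMarkovKernel_projectedEmpirical hn k x
  have hi : Integrable (fun p : Stiefel d k × EuclideanSpace ℝ (Fin k) => f p.2)
      ((stiefelHaar hk).compProd (projectedEmpirical k x)) := by
    have hm : AEStronglyMeasurable (fun p : Stiefel d k × EuclideanSpace ℝ (Fin k) => f p.2)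
        ((stiefelHaar hk).compProd (projectedEmpirical k x)) :=
      (hc.measurable.comp measurable_snd).aestronglyMeasurable
    refine (Measure.integrable_compProd_iff hm).2 ⟨Filter.Eventually.of_forall fun θ => ?_, ?_⟩
    · change Integrable f ((n : ℝ≥0∞)⁻¹ • ∑ i, Measure.dirac (proj θ (x i)))
      exact (integrable_finsetSum_measure.2 fun i _ => integrable_dirac (by simp)).smul_measure
        (by simp; omega)
    · simp only [integral_projectedEmpirical x (f := fun y => ‖f y‖)]
      exact (integrable_finsetSum _ fun i _ =>
        integrable_comp_proj_stiefelHaar hk (x i) hc.norm).const_mul _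
  rw [Measure.integral_compProd hi]
  simp only [integral_projectedEmpirical x]
  rw [integral_const_mul, integral_finsetSum _ fun i _ =>
    integrable_comp_proj_stiefelHaar hk (x i) hc]

end RandomProjection

theorem theorem3p1 {n d k : ℕ} (hn : 1 ≤ n) (hd : 2 ≤ d) (hk : k ≤ d)
    (x : Fin n → EuclideanSpace ℝ (Fin d))
    (σ A : ℝ) (hσ_pos : 0 < σ)
    (hσ : (1 / (n : ℝ)) * ∑ i, ‖x i‖ ^ 2 = σ ^ 2 * d)
    (hA : A = (1 / (n : ℝ)) * ∑ i, |(σ ^ 2)⁻¹ * ‖x i‖ ^ 2 - d|)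
    {Ω : Type*} [MeasurableSpace Ω] (P : Measure Ω) [IsProbabilityMeasure P]
    -- `θ` is a Haar-distributed frame and, given `θ`, the vector `Xθ` is distributed
    -- according to the empirical measure of the projected points
    (θ : Ω → RandomProjection.Stiefel d k) (Xθ : Ω → EuclideanSpace ℝ (Fin k))
    (hX : HasLaw (fun ω => (θ ω, Xθ ω))
      ((RandomProjection.stiefelHaar hk).compProd (RandomProjection.projectedEmpirical k x)) P)
    {Ω' : Type*} [MeasurableSpace Ω'] (Q : Measure Ω') [IsProbabilityMeasure Q]
    (Z : Ω' → EuclideanSpace ℝ (Fin k)) (hZ : HasLaw Z (stdGaussian _) Q) :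
    RandomProjection.dW P Xθ Q (fun ω => σ • Z ω) ≤
      ENNReal.ofReal ((σ * √k * (A + 1) + σ * k) / ((d : ℝ) - 1)) := by
  refine iSup₂_le fun f hLip => ENNReal.ofReal_le_ofReal ?_
  have hc := RandomProjection.continuous_of_abs_sub_le hLip
  have hn0 : (n : ℝ) ≠ 0 := by exact_mod_cast (by omega : n ≠ 0)
  have hd2 : (2 : ℝ) ≤ d := by exact_mod_cast hd
  have hm : Measurable fun p : RandomProjection.Stiefel d k × EuclideanSpace ℝ (Fin k) => f p.2 :=
    hc.measurable.comp measurable_snd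
  have hXint : ∫ ω, f (Xθ ω) ∂P
      = (1 / (n : ℝ)) * ∑ i, ∫ θ, f (RandomProjection.proj θ (x i))
          ∂(RandomProjection.stiefelHaar hk) := by
    rw [← RandomProjection.integral_compProd_stiefelHaar hn hk x hc, ← hX.map_eq,
      integral_map hX.aemeasurable hm.aestronglyMeasurable]
  have hZint : ∫ ω, f (σ • Z ω) ∂Q
      = ∫ z, f (σ • z) ∂stdGaussian (EuclideanSpace ℝ (Fin k)) := by
    rw [← hZ.map_eq,
      integral_map hZ.aemeasurable (Continuous.aestronglyMeasurable (by fun_prop))]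
  have hZavg : ∫ z, f (σ • z) ∂stdGaussian (EuclideanSpace ℝ (Fin k))
      = (1 / (n : ℝ)) * ∑ _i : Fin n, ∫ z, f (σ • z) ∂stdGaussian (EuclideanSpace ℝ (Fin k)) := by
    simp [hn0]
  have hpt : ∀ i, |‖x i‖ ^ 2 - σ ^ 2 * ((d : ℝ) - 1)|
      ≤ σ ^ 2 * |(σ ^ 2)⁻¹ * ‖x i‖ ^ 2 - d| + σ ^ 2 := fun i => by
    have h : ‖x i‖ ^ 2 - σ ^ 2 * ((d : ℝ) - 1)
        = σ ^ 2 * ((σ ^ 2)⁻¹ * ‖x i‖ ^ 2 - d) + σ ^ 2 := by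
      field_simp
      ring
    rw [h]
    refine (abs_add_le _ _).trans ?_
    rw [abs_mul, abs_of_nonneg (sq_nonneg σ)]
  rw [abs_sub_comm, hXint, hZint, hZavg, ← mul_sub, ← Finset.sum_sub_distrib, abs_mul,
    abs_of_nonneg (by positivity)]
  have hpos : 0 < σ * ((d : ℝ) - 1) := mul_pos hσ_pos (by linarith)
  calc _ ≤ (1 / (n : ℝ)) * ∑ i, ((σ ^ 2 * |(σ ^ 2)⁻¹ * ‖x i‖ ^ 2 - d| + σ ^ 2) * √k
        + ‖x i‖ ^ 2 * k / d) / (σ * ((d : ℝ) - 1)) := by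
        gcongr
        refine (Finset.abs_sum_le_sum_abs _ _).trans (Finset.sum_le_sum fun i _ => ?_)
        refine (RandomProjection.abs_integral_stiefelHaar_sub_le hd hk (x i) hσ_pos hLip).trans ?_
        gcongr
        exact hpt i
    _ = ((σ ^ 2 * A + σ ^ 2) * √k + ((1 / (n : ℝ)) * ∑ i, ‖x i‖ ^ 2) * k / d)
          / (σ * ((d : ℝ) - 1)) := by
        rw [hA]
        simp only [add_mul, Finset.sum_add_distrib, ← Finset.sum_div, ← Finset.sum_mul,
          ← Finset.mul_sum, Finset.sum_const, Finset.card_univ, Fintype.card_fin, nsmul_eq_mul]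
        field_simp
    _ = _ := by
        rw [hσ]
        have : (d : ℝ) - 1 ≠ 0 := by linarith
        field_simp
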